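/- All multigraphs are finite; parallel edges are allowed, loops are not. An edge-coloring of a multigraph $G$ into color classes $E_1,\dots,E_n$ is a partition of the edge (multi)set $E(G)$; it is proper if each $E_i$ is a matching. A full rainbow matching is a matching of $G$ that contains exactly one edge from each $E_i$. The chromatic index is the least number of colors in a proper edge-coloring. The following statements hold. (1) For every multigraph $H$ with maximum degree $\Delta\ge 2$ and chromatic index $\chi'$, there exist a multigraph $G$ with maximum degree $\Delta$ and chromatic index $\chi'$ and a proper edge-coloring of $G$ into color classes $E_1,\dots,E_n$ such that $|E_i|\ge\chi'-1$ for every $i$ and there is no full rainbow matching. If $|E(H)|\le 2\Delta-1$, then one can take $|E_i|\ge\chi'$ for every $i$. (2) For every $\Delta\ge 2$, there exist a bipartite (simple) graph $G$ with maximum degree $\Delta$ and a proper edge-coloring of $G$ into color classes $E_1,\dots,E_n$ such that $|E_i|\ge\Delta+1$ for every $i$ and there is no full rainbow matching. (3) For every integer $\Delta\ge 3$ with $\Delta\equiv 3$ or $0\pmod 4$, there exist a multigraph $G$ with maximum degree $\Delta$ and chromatic index $\Delta$, and a proper edge-coloring of $G$ into color classes $E_1,\dots,E_n$, such that $|E_i|\ge\Delta+2$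 for every $i$ and there is no full rainbow matching. If $\Delta\in\{2^m-1,2^m\}$ for some integer $m\ge 2$, then one can take $G$ to be a simple graph. Consequently, both of the following conjectures of Delcourt and Postle are false: (a) if $G$ is a bipartite multigraph of maximum degree $\Delta$ and $E_1,\dots,E_n$ are the color classes of a proper edge-coloring of $G$ with $|E_i|\ge\Delta+1$ for every $i$, then there exists a full rainbow matching; (b) if $G$ is a multigraph of maximum degree $\Delta$ and $E_1,\dots,E_n$ are the color classes of a proper edge-coloring of $G$ with $|E_i|\ge\Delta+2$ for every $i$, then there exists a full rainbow matching. -/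

import Mathlib

open scoped Graph

namespace Graph

variable {α β : Type*}

/-- A finite multigraph: finitely many vertices and edges, parallel edges allowed, and every edge
has exactly two distinct ends. -/
structure IsFiniteMultigraph (G : Graph α β) : Prop where
  finite_vertexSet : V(G).Finite
  finite_edgeSet : E(G).Finite
  loopless : G.Loopless

/-- The maximum degree: the supremum over the vertices `v` of the number of edges containing `v`
(edges are counted with multiplicity). -/
noncomputable def maxDegree (G : Graph α β) : ℕ∞ :=
  ⨆ v ∈ V(G), (G.incidenceSet v).encard

/-- `G` is bipartite: its vertices are split into `A` and its complement such that every edge has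
one end in each. -/
def IsBipartite (G : Graph α β) : Prop :=
  ∃ A : Set α, ∀ e x y, G.IsLink e x y → (x ∈ A ↔ y ∉ A)

/-- A set of edges is a matching if distinct edges in it have no common end. -/
def IsMatching (G : Graph α β) (M : Set E(G)) : Prop :=
  ∀ e ∈ M, ∀ f ∈ M, e ≠ f → ∀ x, ¬ (G.Inc e x ∧ G.Inc f x)

/-- The colour class of the colour `i` in an edge-colouring with colours `Fin n`. -/
def colorClass (G : Graph α β) {n : ℕ} (c : E(G) → Fin n) (i : Fin n) : Set E(G) :=
  {e | c e = i}

/-- An edge-colouring is proper if each colour class is a matching. -/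
def IsProperEdgeColoring (G : Graph α β) {n : ℕ} (c : E(G) → Fin n) : Prop :=
  ∀ i, G.IsMatching (G.colorClass c i)

/-- The least number of colours in a proper edge-colouring (`⊤` if there is none). -/
noncomputable def chromaticIndex (G : Graph α β) : ℕ∞ :=
  ⨅ n ∈ {n : ℕ | ∃ c : E(G) → Fin n, G.IsProperEdgeColoring c}, (n : ℕ∞)

/-- A full rainbow matching: a matching that contains exactly one edge from each colour class. -/
def IsFullRainbowMatching (G : Graph α β) {n : ℕ} (c : E(G) → Fin n) (M : Set E(G)) : Prop :=
  G.IsMatching M ∧ ∀ i, ∃! e, e ∈ M ∧ e ∈ G.colorClass c i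

end Graph

/-- Delcourt and Postle's conjecture for bipartite multigraphs: a proper edge-colouring of a
bipartite multigraph of maximum degree `Δ` whose colour classes all have size at least `Δ + 1` has
a full rainbow matching. -/
def DelcourtPostleBipartiteConjecture : Prop :=
  ∀ (V F : Type) (G : Graph V F) (Δ n : ℕ) (c : E(G) → Fin n),
    G.IsFiniteMultigraph → G.IsBipartite → G.maxDegree = Δ → G.IsProperEdgeColoring c →
    (∀ i, Δ + 1 ≤ (G.colorClass c i).ncard) → ∃ M, G.IsFullRainbowMatching c M

/-- Delcourt and Postle's conjecture for general multigraphs: a proper edge-colouring of a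
multigraph of maximum degree `Δ` whose colour classes all have size at least `Δ + 2` has a full
rainbow matching. -/
def DelcourtPostleGeneralConjecture : Prop :=
  ∀ (V F : Type) (G : Graph V F) (Δ n : ℕ) (c : E(G) → Fin n),
    G.IsFiniteMultigraph → G.maxDegree = Δ → G.IsProperEdgeColoring c →
    (∀ i, Δ + 2 ≤ (G.colorClass c i).ncard) → ∃ M, G.IsFullRainbowMatching c M

/-! The core is a gadget that enlarges colour classes without creating a full rainbow matching. Let
`d = Δ - 1`, and let `M` be a properly coloured multigraph of maximum degree at most `Δ` with no
full rainbow matching. Take `2d + 1` copies of `M` with separate colours, one copy being special,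
and for each other copy a double star with `d` leaves at each centre. The central edge gets a colour
of the special copy, the pendant edges get colours of the copy that the star belongs to. The special
copy cannot represent all its colours by its own edges, so a full rainbow matching uses the central
edge of some star. The copy of that star must likewise use a pendant edge of the star, but this
meets the central edge (`NoFullRainbow.withDoubleStars`). Each copy has `2d` star edges to
distribute over its colours, so every class gains one edge if `M` has between `d` and `2d` colours,
and two if it has exactly `d`.

Three base examples are fed into the gadget. For bipartite graphs: `K_{n,n}` with the addition table
of `ZMod n`, `n` even, which has no transversal because the elements of `ZMod n` do not sum to zero.
For classes of size `Δ + 2`: translations of an elementary abelian 2-group, where a full rainbow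
matching would miss just two vertices and a sum over all vertices would force these to coincide. For
prescribed `Δ` and `χ`: `χ - 1` triangles of `χ` pairwise intersecting edges each, one of each
colour, so that `χ` colours would need `χ` triangles.

In statement (1) only `Δ` and `χ` matter. Shannon's theorem `2χ ≤ 3Δ` is exactly what keeps the
degrees in the triangles at most `Δ`. It is proved by extending a partial colouring to an uncoloured
edge `xy`: otherwise the sets of colours missing at `x`, `y` and a suitable neighbour `z` of `x` are
pairwise disjoint, which is too many colours. -/

/-- A loopless multigraph with vertex type `V` and edge type `F`, each edge having a first and a
second end. -/
structure Multigraph (V F : Type*) where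
  /-- the first end of an edge -/
  fst : F → V
  /-- the second end of an edge -/
  snd : F → V
  ne : ∀ f, fst f ≠ snd f

namespace Multigraph

variable {V F C : Type*} (M : Multigraph V F)

/-- The vertex `v` is an end of the edge `f`. -/
def Inc (f : F) (v : V) : Prop := M.fst f = v ∨ M.snd f = v

lemma exists_other_end {f : F} {v : V} (h : M.Inc f v) :
    ∃ w, w ≠ v ∧ M.Inc f w ∧ ∀ u, M.Inc f u → u = v ∨ u = w := by
  have hne := M.ne f
  rcases h with h | h
  · exact ⟨M.snd f, by grind, Or.inr rfl, by unfold Inc; grind⟩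
  · exact ⟨M.fst f, by grind, Or.inl rfl, by unfold Inc; grind⟩

/-- Edges with a common end that have the same colour are equal or uncoloured. -/
def IsPartialColoring (c : F → Option C) : Prop :=
  ∀ e f v, e ≠ f → M.Inc e v → M.Inc f v → c e = c f → c e = none

/-- The colour `a` does not occur at the vertex `v`. -/
def Misses (c : F → Option C) (v : V) (a : C) : Prop := ∀ f, M.Inc f v → c f ≠ some a

/-! ### Recolouring moves on partial edge-colourings -/

section Recolour

variable {M} {c : F → Option C}

open Classical in
lemma IsPartialColoring.update (hc : M.IsPartialColoring c) {e : F} {a : C}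
    (ha : ∀ v, M.Inc e v → M.Misses c v a) :
    M.IsPartialColoring (Function.update c e (some a)) := by
  intro f g v hfg hf hg h
  by_cases hfe : f = e
  · subst hfe
    rw [Function.update_self, Function.update_of_ne hfg.symm] at h
    exact absurd h.symm (ha v hf g hg)
  · rw [Function.update_of_ne hfe] at h ⊢
    by_cases hge : g = e
    · subst hge
      rw [Function.update_self] at h
      exact absurd h (ha v hg f hf)
    · rw [Function.update_of_ne hge] at h
      exact hc f g v hfg hf hg h

open Classical in
lemma extend_of_common_missing (hc : M.IsPartialColoring c) {e : F} {x y : V}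
    (hends : ∀ u, M.Inc e u → u = x ∨ u = y) {a : C} (hx : M.Misses c x a)
    (hy : M.Misses c y a) :
    ∃ c' : F → Option C, M.IsPartialColoring c' ∧ c' e ≠ none ∧ ∀ f, c f ≠ none → c' f ≠ none := by
  refine ⟨Function.update c e (some a), hc.update ?_, by simp, ?_⟩
  · intro v hv
    rcases hends v hv with rfl | rfl <;> assumption
  · intro f hf
    by_cases h : f = e
    · subst h; simp
    · rwa [Function.update_of_ne h]

open Classical in
-- Recolouring `g` from `b` to `d` frees `b` at `x`; then `b` is missing at both ends of `e`.
lemma extend_of_fan (hc : M.IsPartialColoring c) {e g : F} {x y z : V}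
    (hends : ∀ u, M.Inc e u → u = x ∨ u = y) (hxy : y ≠ x) (hzy : z ≠ y)
    (hgx : M.Inc g x) (hg : ∀ u, M.Inc g u → u = x ∨ u = z) {b d : C}
    (hb : c g = some b) (hby : M.Misses c y b) (hdx : M.Misses c x d) (hdz : M.Misses c z d) :
    ∃ c' : F → Option C, M.IsPartialColoring c' ∧ c' e ≠ none ∧ ∀ f, c f ≠ none → c' f ≠ none := by
  have hbd : d ≠ b := fun h => hdx g hgx (h ▸ hb)
  have hc1 : M.IsPartialColoring (Function.update c g (some d)) := hc.update (by
    intro v hv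
    rcases hg v hv with rfl | rfl <;> assumption)
  obtain ⟨c', h1, h2, h3⟩ := extend_of_common_missing (e := e) (x := x) (y := y) (a := b) hc1 hends
    (by
      intro f hf
      by_cases hfg : f = g
      · subst hfg; simpa using hbd
      · rw [Function.update_of_ne hfg]
        intro h
        have := hc f g x hfg hf hgx (h.trans hb.symm)
        simp [h] at this)
    (by
      intro f hf
      by_cases hfg : f = g
      · subst hfg; simpa using hbd
      · rw [Function.update_of_ne hfg]
        exact hby f hf)
  refine ⟨c', h1, h2, fun f hf => h3 f ?_⟩
  by_cases hfg : f = g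
  · subst hfg; simp
  · rwa [Function.update_of_ne hfg]

open Classical in
/-- Exchange the colours `a` and `b` on the edges whose first end is in `K`. -/
noncomputable def kempeSwap (M : Multigraph V F) (c : F → Option C) (K : Set V) (a b : C) :
    F → Option C :=
  fun f => if M.fst f ∈ K then (c f).map (Equiv.swap a b) else c f

lemma kempeSwap_eq_none {K : Set V} {a b : C} {f : F} :
    M.kempeSwap c K a b f = none ↔ c f = none := by
  unfold kempeSwap; split_ifs <;> simp

/-- A set of vertices that contains both ends or no end of each edge coloured `a` or `b`. -/
def IsKempeClosed (M : Multigraph V F) (c : F → Option C) (K : Set V) (a b : C) : Prop :=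
  ∀ f, c f = some a ∨ c f = some b → (M.fst f ∈ K ↔ M.snd f ∈ K)

open Classical in
lemma kempeSwap_apply {K : Set V} {a b : C} (hK : M.IsKempeClosed c K a b) {f : F} {v : V}
    (hv : M.Inc f v) :
    M.kempeSwap c K a b f = if v ∈ K then (c f).map (Equiv.swap a b) else c f := by
  by_cases h : c f = some a ∨ c f = some b
  · have := hK f h
    unfold kempeSwap
    rcases hv with rfl | rfl
    · rfl
    · simp only [this]
  · have : (c f).map (Equiv.swap a b) = c f := by
      cases hcf : c f with
      | none => rfl
      | some d =>
        rw [hcf] at h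
        simp only [Option.some.injEq, not_or] at h
        simp [Equiv.swap_apply_of_ne_of_ne h.1 h.2]
    simp [kempeSwap, this]

lemma IsPartialColoring.kempeSwap (hc : M.IsPartialColoring c) {K : Set V} {a b : C}
    (hK : M.IsKempeClosed c K a b) : M.IsPartialColoring (M.kempeSwap c K a b) := by
  classical
  intro e f v hef he hf h
  rw [kempeSwap_apply hK he, kempeSwap_apply hK hf] at h
  rw [kempeSwap_eq_none]
  refine hc e f v hef he hf ?_
  split_ifs at h
  · exact Option.map_injective (Equiv.injective _) h
  · exact h

lemma misses_kempeSwap_of_mem {K : Set V} {a b : C} (hK : M.IsKempeClosed c K a b) {v : V}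
    (hv : v ∈ K) (h : M.Misses c v b) : M.Misses (M.kempeSwap c K a b) v a := by
  classical
  intro f hf
  rw [kempeSwap_apply hK hf, if_pos hv]
  intro h'
  obtain ⟨d, hd, hd'⟩ := Option.map_eq_some_iff.1 h'
  rw [Equiv.swap_apply_eq_iff, Equiv.swap_apply_left] at hd'
  exact h f hf (hd' ▸ hd)

lemma misses_kempeSwap_of_notMem {K : Set V} {a b d : C} (hK : M.IsKempeClosed c K a b) {v : V}
    (hv : v ∉ K) (h : M.Misses c v d) : M.Misses (M.kempeSwap c K a b) v d := by
  classical
  intro f hf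
  rw [kempeSwap_apply hK hf, if_neg hv]
  exact h f hf

end Recolour

/-! ### Two-coloured components -/

section Kempe

variable {M} {c : F → Option C}

/-- The simple graph formed by the edges coloured `a` or `b`. -/
def kempeGraph (M : Multigraph V F) (c : F → Option C) (a b : C) : SimpleGraph V where
  Adj u v := u ≠ v ∧ ∃ f, (c f = some a ∨ c f = some b) ∧ M.Inc f u ∧ M.Inc f v
  symm := ⟨fun _ _ ⟨h, f, h1, h2, h3⟩ => ⟨h.symm, f, h1, h3, h2⟩⟩

lemma isKempeClosed_supp (a b : C) (K : (M.kempeGraph c a b).ConnectedComponent) :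
    M.IsKempeClosed c K.supp a b := by
  intro f hf
  have hadj : (M.kempeGraph c a b).Adj (M.fst f) (M.snd f) :=
    ⟨M.ne f, f, hf, Or.inl rfl, Or.inr rfl⟩
  simp only [SimpleGraph.ConnectedComponent.mem_supp_iff]
  rw [SimpleGraph.ConnectedComponent.connectedComponentMk_eq_of_adj hadj]

lemma neighbor_unique_of_color (hc : M.IsPartialColoring c) {d : C} {u v w : V} {f g : F}
    (huv : u ≠ v) (huw : u ≠ w) (hf : c f = some d) (hg : c g = some d)
    (hfu : M.Inc f u) (hfv : M.Inc f v) (hgu : M.Inc g u) (hgw : M.Inc g w) : v = w := by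
  have : f = g := by
    by_contra hne
    have := hc f g u hne hfu hgu (hf.trans hg.symm)
    simp [hf] at this
  subst this
  unfold Inc at *
  grind

open Classical in
lemma card_neighbors_le (hc : M.IsPartialColoring c) (a b : C) (u : V) (S : Finset C)
    (hS : ∀ d, (d = a ∨ d = b) → ¬ M.Misses c u d → d ∈ S) (T : Finset V)
    (hT : ∀ v ∈ T, (M.kempeGraph c a b).Adj u v) : T.card ≤ S.card := by
  have key : ∀ v ∈ T, ∃ d ∈ S, ∃ f, c f = some d ∧ M.Inc f u ∧ M.Inc f v := by
    intro v hv
    obtain ⟨_, f, hf, hfu, hfv⟩ := hT v hv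
    rcases hf with hf | hf
    · exact ⟨a, hS a (Or.inl rfl) (fun h => h f hfu hf), f, hf, hfu, hfv⟩
    · exact ⟨b, hS b (Or.inr rfl) (fun h => h f hfu hf), f, hf, hfu, hfv⟩
  have : Nonempty C := ⟨a⟩
  rcases T.eq_empty_or_nonempty with rfl | ⟨v₀, hv₀⟩
  · simp
  have : Nonempty F := ⟨(key v₀ hv₀).choose_spec.2.choose⟩
  choose! D hD f hf hfu hfv using key
  refine Finset.card_le_card_of_injOn D (fun v hv => hD v hv) ?_
  intro v hv w hw hvw
  exact neighbor_unique_of_color hc (hT v hv).1 (hT w hw).1 (hf v hv)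
    (hvw ▸ hf w hw) (hfu v hv) (hfv v hv) (hfu w hw) (hfv w hw)

/-- A connected component of the graph of the edges coloured `a` or `b` cannot contain three
vertices that miss one of the two colours. -/
lemma exists_not_reachable [Fintype V] (hc : M.IsPartialColoring c) {a b : C} {x y z : V}
    (hxy : x ≠ y) (hxz : x ≠ z) (hyz : y ≠ z) (hx : M.Misses c x a) (hy : M.Misses c y b)
    (hz : M.Misses c z b) (K : (M.kempeGraph c a b).ConnectedComponent)
    (hxK : x ∈ K.supp) (hyK : y ∈ K.supp) (hzK : z ∈ K.supp) : False := by
  classical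
  have hconn := K.connected_toSimpleGraph
  have h1 := hconn.card_vert_le_card_edgeSet_add_one
  have h2 := K.toSimpleGraph.sum_degrees_eq_twice_card_edges
  have hdeg : ∀ (u : K) (S : Finset C),
      (∀ d, (d = a ∨ d = b) → ¬ M.Misses c u d → d ∈ S) → K.toSimpleGraph.degree u ≤ S.card := by
    intro u S hS
    rw [← SimpleGraph.card_neighborFinset_eq_degree,
      ← Finset.card_map (Function.Embedding.subtype _)]
    refine card_neighbors_le hc a b u S hS _ ?_
    intro v hv
    rw [Finset.mem_map] at hv
    obtain ⟨w, hw, rfl⟩ := hv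
    rw [SimpleGraph.mem_neighborFinset] at hw
    exact hw
  let x' : K := ⟨x, hxK⟩
  let y' : K := ⟨y, hyK⟩
  let z' : K := ⟨z, hzK⟩
  have hx1 : K.toSimpleGraph.degree x' ≤ 1 := hdeg x' {b} (by
    rintro d (rfl | rfl) h
    · exact absurd hx h
    · simp)
  have hy1 : K.toSimpleGraph.degree y' ≤ 1 := hdeg y' {a} (by
    rintro d (rfl | rfl) h
    · simp
    · exact absurd hy h)
  have hz1 : K.toSimpleGraph.degree z' ≤ 1 := hdeg z' {a} (by
    rintro d (rfl | rfl) h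
    · simp
    · exact absurd hz h)
  -- Degrees are at most 2, and at most 1 at the three given vertices. On `n` vertices the degree
  -- sum is at most `2n - 3`, whereas connectedness requires at least `2n - 2`.
  have hle : ∀ u : K, K.toSimpleGraph.degree u +
      (if u ∈ ({x', y', z'} : Finset K) then 1 else 0) ≤ 2 := by
    intro u
    split_ifs with hu
    · simp only [Finset.mem_insert, Finset.mem_singleton] at hu
      rcases hu with rfl | rfl | rfl <;> omega
    · exact (hdeg u {a, b} (by rintro d (rfl | rfl) _ <;> simp)).trans Finset.card_le_two
  have hsum := Finset.sum_le_sum (fun u (_ : u ∈ (Finset.univ : Finset K)) => hle u)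
  rw [Finset.sum_add_distrib, h2, Finset.sum_const, Finset.card_univ, ← Finset.sum_filter,
    Finset.sum_const, Finset.filter_mem_eq_inter, Finset.univ_inter] at hsum
  have h3 : ({x', y', z'} : Finset K).card = 3 :=
    Finset.card_eq_three.2 ⟨x', y', z', by simpa [x', y'] using hxy, by simpa [x', z'] using hxz,
      by simpa [y', z'] using hyz, rfl⟩
  rw [Nat.card_eq_fintype_card, Nat.card_eq_fintype_card, ← SimpleGraph.edgeFinset_card] at h1
  rw [h3] at hsum
  simp only [smul_eq_mul, mul_one] at hsum
  omega

end Kempe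

/-! ### Shannon's bound on the number of colours -/

section Shannon

variable {M}

open Classical in
lemma card_le_card_missing_add [Fintype C] [Fintype F] (c : F → Option C) (v : V) :
    Fintype.card C ≤ (Finset.univ.filter fun a => M.Misses c v a).card +
      (Finset.univ.filter fun f => M.Inc f v ∧ c f ≠ none).card := by
  rw [← Finset.card_univ, ← Finset.card_filter_add_card_filter_not (fun a => M.Misses c v a)]
  refine Nat.add_le_add_left ?_ _
  have key : ∀ a ∈ Finset.univ.filter (fun a => ¬ M.Misses c v a),
      ∃ f, M.Inc f v ∧ c f = some a := by
    intro a ha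
    simpa [Misses] using ha
  rcases isEmpty_or_nonempty F with hF | hF
  · simp [Misses]
  choose! f hf hfa using key
  refine Finset.card_le_card_of_injOn f (fun a ha => ?_) ?_
  · simp only [Finset.coe_filter, Finset.mem_univ, true_and, Set.mem_ofPred_eq]
    exact ⟨hf a ha, by simp [hfa a ha]⟩
  · intro a ha b hb hab
    have := (hfa a ha).symm.trans (hab ▸ hfa b hb)
    exact Option.some_injective _ this

open Classical in
lemma extend_coloring [Fintype V] [Fintype F] [Fintype C] {Δ : ℕ}
    (hΔ : ∀ v, (Finset.univ.filter fun f => M.Inc f v).card ≤ Δ)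
    (hk : 3 * Δ ≤ 2 * Fintype.card C + 1) {c : F → Option C} (hc : M.IsPartialColoring c) {e : F}
    (he : c e = none) :
    ∃ c' : F → Option C, M.IsPartialColoring c' ∧ c' e ≠ none ∧ ∀ f, c f ≠ none → c' f ≠ none := by
  by_contra hno
  obtain ⟨x, hex⟩ : ∃ x, M.Inc e x := ⟨_, Or.inl rfl⟩
  obtain ⟨y, hyx, hey, hends⟩ := M.exists_other_end hex
  set mis : V → Finset C := fun v => Finset.univ.filter fun a => M.Misses c v a with hmis
  have hcount : ∀ v, Fintype.card C ≤ (mis v).card + Δ := fun v =>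
    (card_le_card_missing_add c v).trans <| Nat.add_le_add_left
      ((Finset.card_le_card (Finset.monotone_filter_right _ fun f _ h => h.1)).trans (hΔ v)) _
  -- The uncoloured edge `e` leaves one more colour missing at each of its ends.
  have hcount' : ∀ v, M.Inc e v → Fintype.card C + 1 ≤ (mis v).card + Δ := by
    intro v hv
    have h1 := card_le_card_missing_add (M := M) c v
    have h2 : (Finset.univ.filter fun f => M.Inc f v ∧ c f ≠ none).card <
        (Finset.univ.filter fun f => M.Inc f v).card := by
      refine Finset.card_lt_card ⟨Finset.monotone_filter_right _ fun f _ h => h.1, fun h => ?_⟩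
      have := h (Finset.mem_filter.2 ⟨Finset.mem_univ e, hv⟩)
      simp [he] at this
    have h3 := hΔ v
    change _ ≤ (mis v).card + _ at h1
    omega
  have hΔ1 : 1 ≤ Δ := (Finset.card_pos.2 ⟨e, by simp [hex]⟩).trans_le (hΔ x)
  have hxy : ∀ a, M.Misses c x a → ¬ M.Misses c y a := fun a h1 h2 =>
    hno (extend_of_common_missing hc hends h1 h2)
  obtain ⟨b, hb⟩ : (mis y).Nonempty := by
    rw [← Finset.card_pos]; have := hcount' y hey; omega
  obtain ⟨a, ha⟩ : (mis x).Nonempty := by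
    rw [← Finset.card_pos]; have := hcount' x hex; omega
  simp only [hmis, Finset.mem_filter, Finset.mem_univ, true_and] at ha hb
  have hbx : ¬ M.Misses c x b := fun h => hxy b h hb
  obtain ⟨g, hgx, hgb⟩ : ∃ g, M.Inc g x ∧ c g = some b := by simpa [Misses] using hbx
  obtain ⟨z, hzx, hgz, hg⟩ := M.exists_other_end hgx
  have hzy : z ≠ y := fun h => hb g (h ▸ hgz) hgb
  have hxz : ∀ d, M.Misses c x d → ¬ M.Misses c z d := fun d h1 h2 =>
    hno (extend_of_fan hc hends hyx hzy hgx hg hgb hb h1 h2)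
  have hyz : ∀ d, M.Misses c y d → ¬ M.Misses c z d := by
    intro d hdy hdz
    have hbd : b ≠ d := fun h => hdz g hgz (h ▸ hgb)
    have hba : b ≠ a := fun h => hbx (h ▸ ha)
    -- The `a`/`d` component of `x` cannot contain both `y` and `z`. Exchanging `a` and `d` on the
    -- component of the one outside makes `a` missing there while it stays missing at `x`. For `z`
    -- this allows the fan move, for `y` it allows colouring `e` with `a`.
    by_cases hcomp : y ∈ ((M.kempeGraph c a d).connectedComponentMk x).supp
    · have hz : z ∉ ((M.kempeGraph c a d).connectedComponentMk x).supp := fun hz =>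
        exists_not_reachable hc hyx.symm hzx.symm hzy.symm ha hdy hdz _
          (SimpleGraph.ConnectedComponent.connectedComponentMk_mem) hcomp hz
      set K := ((M.kempeGraph c a d).connectedComponentMk z) with hKdef
      have hK := isKempeClosed_supp a d K
      have hxK : x ∉ K.supp := fun h => hz (by
        rw [SimpleGraph.ConnectedComponent.mem_supp_iff] at h ⊢; exact h.symm)
      have hyK : y ∉ K.supp := fun h => hz (by
        rw [SimpleGraph.ConnectedComponent.mem_supp_iff] at h hcomp ⊢
        rw [← hcomp, h])
      obtain ⟨c', h1, h2, h3⟩ := extend_of_fan (hc.kempeSwap hK) (e := e) (g := g) (b := b) (d := a)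
        hends hyx hzy hgx hg
        (by rw [kempeSwap_apply hK hgx, if_neg hxK, hgb]) (misses_kempeSwap_of_notMem hK hyK hb)
        (misses_kempeSwap_of_notMem hK hxK ha)
        (misses_kempeSwap_of_mem hK SimpleGraph.ConnectedComponent.connectedComponentMk_mem hdz)
      exact hno ⟨c', h1, h2, fun f hf => h3 f (mt kempeSwap_eq_none.1 hf)⟩
    · set K := ((M.kempeGraph c a d).connectedComponentMk y) with hKdef
      have hK := isKempeClosed_supp a d K
      have hxK : x ∉ K.supp := fun h => hcomp (by
        rw [SimpleGraph.ConnectedComponent.mem_supp_iff] at h ⊢; exact h.symm)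
      obtain ⟨c', h1, h2, h3⟩ := extend_of_common_missing (hc.kempeSwap hK) (e := e) (a := a) hends
        (misses_kempeSwap_of_notMem hK hxK ha)
        (misses_kempeSwap_of_mem hK SimpleGraph.ConnectedComponent.connectedComponentMk_mem hdy)
      exact hno ⟨c', h1, h2, fun f hf => h3 f (mt kempeSwap_eq_none.1 hf)⟩
  have hd1 : Disjoint (mis x) (mis y) := Finset.disjoint_left.2 fun d h1 h2 =>
    hxy d (by simpa [hmis] using h1) (by simpa [hmis] using h2)
  have hd2 : Disjoint (mis x ∪ mis y) (mis z) := Finset.disjoint_left.2 fun d h1 h2 => by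
    simp only [hmis, Finset.mem_union, Finset.mem_filter, Finset.mem_univ, true_and] at h1 h2
    exact h1.elim (fun h => hxz d h h2) (fun h => hyz d h h2)
  -- With `k` colours, the three disjoint sets have at least `3(k - Δ) + 2` elements, more than `k`
  -- since `3Δ ≤ 2k + 1`.
  have htot := Finset.card_le_univ ((mis x ∪ mis y) ∪ mis z)
  rw [Finset.card_union_of_disjoint hd2, Finset.card_union_of_disjoint hd1] at htot
  have e1 := hcount' x hex
  have e2 := hcount' y hey
  have e3 := hcount z
  omega

open Classical in
/-- **Shannon's theorem**: a multigraph of maximum degree at most `Δ` has a proper edge-colouring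
with `k` colours whenever `3 * Δ ≤ 2 * k + 1`. -/
theorem exists_coloring_of_degree_le [Fintype V] [Fintype F] [Fintype C] {Δ : ℕ}
    (hΔ : ∀ v, (Finset.univ.filter fun f => M.Inc f v).card ≤ Δ)
    (hk : 3 * Δ ≤ 2 * Fintype.card C + 1) :
    ∃ c : F → C, ∀ e f v, e ≠ f → M.Inc e v → M.Inc f v → c e ≠ c f := by
  have key : ∀ S : Finset F, ∃ c : F → Option C, M.IsPartialColoring c ∧ ∀ f ∈ S, c f ≠ none := by
    intro S
    induction S using Finset.induction_on with
    | empty => exact ⟨fun _ => none, fun _ _ _ _ _ _ _ => rfl, by simp⟩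
    | insert e S _ ih =>
      obtain ⟨c, hc, hS⟩ := ih
      by_cases he : c e = none
      · obtain ⟨c', h1, h2, h3⟩ := extend_coloring hΔ hk hc he
        refine ⟨c', h1, fun f hf => ?_⟩
        rcases Finset.mem_insert.1 hf with rfl | hf
        · exact h2
        · exact h3 f (hS f hf)
      · refine ⟨c, hc, fun f hf => ?_⟩
        rcases Finset.mem_insert.1 hf with rfl | hf
        · exact he
        · exact hS f hf
  obtain ⟨c, hc, hS⟩ := key Finset.univ
  have hsome : ∀ f, ∃ a, c f = some a := fun f =>
    Option.ne_none_iff_exists'.1 (hS f (Finset.mem_univ f))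
  choose c' hc' using hsome
  refine ⟨c', fun e f v hef he hf h => ?_⟩
  have := hc e f v hef he hf (by rw [hc', hc', h])
  simp [hc'] at this

end Shannon

/-! ### Colourings without full rainbow matchings -/

section Properties

variable {V F C : Type*} (M : Multigraph V F)

/-- A proper edge-colouring of a multigraph of maximum degree at most `Δ` all of whose colour
classes have at least `T` edges. -/
structure IsColored (κ : F → C) (Δ T : ℕ) : Prop where
  proper : ∀ e f v, e ≠ f → M.Inc e v → M.Inc f v → κ e ≠ κ f
  degree_le : ∀ v, {f | M.Inc f v}.encard ≤ Δ
  le_class : ∀ a, (T : ℕ∞) ≤ {f | κ f = a}.encard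

/-- Every choice of one edge of each colour contains two edges with a common end. -/
def NoFullRainbow (κ : F → C) : Prop :=
  ∀ r : C → F, (∀ a, κ (r a) = a) → ∃ a b v, a ≠ b ∧ M.Inc (r a) v ∧ M.Inc (r b) v

/-- There are no parallel edges. -/
def IsSimple : Prop :=
  ∀ e f x y, x ≠ y → M.Inc e x → M.Inc e y → M.Inc f x → M.Inc f y → e = f

/-- Each edge has exactly one end in `A`. -/
def IsBipartiteWith (A : Set V) : Prop := ∀ f, M.fst f ∈ A ↔ M.snd f ∉ A

variable {M}

lemma encard_inc_le [Fintype C] {κ : F → C}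
    (h : ∀ e f v, e ≠ f → M.Inc e v → M.Inc f v → κ e ≠ κ f) (v : V) :
    {f | M.Inc f v}.encard ≤ Fintype.card C := by
  have hinj : Set.InjOn κ {f | M.Inc f v} := by
    intro e he f hf hef
    by_contra hne
    exact h e f v hne he hf hef
  rw [← hinj.encard_image, ← ENat.card_eq_coe_fintype_card, ← Set.encard_univ]
  exact Set.encard_le_encard (Set.subset_univ _)

end Properties

/-! ### The double star gadget -/

section DoubleStars

variable {V F C : Type*} (M : Multigraph V F)

/-- The disjoint union of `2 * d + 1` copies of `M` and `2 * d` double stars, whose two centres are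
adjacent and have `d` leaves each. Double stars, and the leaves of each of them, are indexed by
`Fin d × Bool`. -/
def withDoubleStars (d : ℕ) :
    Multigraph ((Option (Fin d × Bool) × V) ⊕ ((Fin d × Bool) × (Bool ⊕ (Fin d × Bool))))
      ((Option (Fin d × Bool) × F) ⊕ ((Fin d × Bool) ⊕ ((Fin d × Bool) × (Fin d × Bool)))) where
  fst
    | .inl (g, f) => .inl (g, M.fst f)
    | .inr (.inl i) => .inr (i, .inl false)
    | .inr (.inr (i, p)) => .inr (i, .inl p.2)
  snd
    | .inl (g, f) => .inl (g, M.snd f)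
    | .inr (.inl i) => .inr (i, .inl true)
    | .inr (.inr (i, p)) => .inr (i, .inr p)
  ne := by
    rintro (⟨g, f⟩ | i | ⟨i, p⟩)
    · simpa using M.ne f
    · simp
    · simp

/-- The edges in a copy of `M` are coloured by `κ`, with separate colours for separate copies. The
central edges of the double stars are coloured with the colours of one special copy, and the pendant
edges of each double star with the colours of another copy. -/
def doubleStarColor {d : ℕ} (κ : F → C) (φ : Fin d × Bool → C) :
    (Option (Fin d × Bool) × F) ⊕ ((Fin d × Bool) ⊕ ((Fin d × Bool) × (Fin d × Bool))) →
      Option (Fin d × Bool) × C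
  | .inl (g, f) => (g, κ f)
  | .inr (.inl i) => (none, φ i)
  | .inr (.inr (i, p)) => (some i, φ p)

variable {M} {d : ℕ}

@[simp] lemma withDoubleStars_inc_copy_copy {g g' : Option (Fin d × Bool)} {f : F} {v : V} :
    (M.withDoubleStars d).Inc (.inl (g, f)) (.inl (g', v)) ↔ g = g' ∧ M.Inc f v := by
  simp [Inc, withDoubleStars]; tauto

@[simp] lemma withDoubleStars_inc_copy_star {x : Option (Fin d × Bool) × F}
    {w : (Fin d × Bool) × (Bool ⊕ (Fin d × Bool))} :
    ¬ (M.withDoubleStars d).Inc (.inl x) (.inr w) := by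
  simp [Inc, withDoubleStars]

@[simp] lemma withDoubleStars_inc_star_copy
    {e : (Fin d × Bool) ⊕ ((Fin d × Bool) × (Fin d × Bool))} {w : Option (Fin d × Bool) × V} :
    ¬ (M.withDoubleStars d).Inc (.inr e) (.inl w) := by
  rcases e with i | ⟨i, p⟩ <;> simp [Inc, withDoubleStars]

@[simp] lemma withDoubleStars_inc_center_center {i j : Fin d × Bool} {b : Bool} :
    (M.withDoubleStars d).Inc (.inr (.inl i)) (.inr (j, .inl b)) ↔ i = j := by
  cases b <;> simp [Inc, withDoubleStars]

@[simp] lemma withDoubleStars_inc_center_leaf {i j p : Fin d × Bool} :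
    ¬ (M.withDoubleStars d).Inc (.inr (.inl i)) (.inr (j, .inr p)) := by
  simp [Inc, withDoubleStars]

@[simp] lemma withDoubleStars_inc_pendant_center {i j p : Fin d × Bool} {b : Bool} :
    (M.withDoubleStars d).Inc (.inr (.inr (i, p))) (.inr (j, .inl b)) ↔ i = j ∧ p.2 = b := by
  simp [Inc, withDoubleStars]

@[simp] lemma withDoubleStars_inc_pendant_leaf {i j p q : Fin d × Bool} :
    (M.withDoubleStars d).Inc (.inr (.inr (i, p))) (.inr (j, .inr q)) ↔ i = j ∧ p = q := by
  simp [Inc, withDoubleStars]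

/-- Every copy, the special one included, must have some colour represented in a double star. For
the special copy this is a central edge; for the copy attached to that same star it is a pendant
edge, which shares a centre with it. -/
lemma NoFullRainbow.withDoubleStars {κ : F → C} (h : M.NoFullRainbow κ) (φ : Fin d × Bool → C) :
    (M.withDoubleStars d).NoFullRainbow (doubleStarColor κ φ) := by
  intro r hr
  by_contra! hno
  have key : ∀ g, ∃ a x, r (g, a) = .inr x := by
    intro g
    by_contra! hg
    have hcopy : ∀ a, ∃ f, r (g, a) = .inl (g, f) ∧ κ f = a := by
      intro a
      have h1 := hr (g, a)
      rcases hra : r (g, a) with ⟨g', f⟩ | x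
      · rw [hra] at h1
        simp only [doubleStarColor, Prod.mk.injEq] at h1
        exact ⟨f, by rw [h1.1], h1.2⟩
      · exact absurd hra (hg a x)
    choose r' hr' hκ using hcopy
    obtain ⟨a, b, v, hab, ha, hb⟩ := h r' hκ
    refine hno (g, a) (g, b) (.inl (g, v)) (by simpa using hab) ?_ ?_
    · rw [hr']; simpa using ha
    · rw [hr']; simpa using hb
  obtain ⟨a, x, hx⟩ := key none
  have hi : ∃ i, x = .inl i := by
    rcases x with i | ⟨i, p⟩
    · exact ⟨i, rfl⟩
    · have := hr (none, a)
      simp [hx, doubleStarColor] at this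
  obtain ⟨i, rfl⟩ := hi
  obtain ⟨b, y, hy⟩ := key (some i)
  have h1 := hr (some i, b)
  rcases y with j | ⟨j, p⟩
  · simp [hy, doubleStarColor] at h1
  · simp only [hy, doubleStarColor, Prod.mk.injEq, Option.some.injEq] at h1
    refine hno (none, a) (some i, b) (.inr (i, .inl p.2)) (by simp) ?_ ?_
    · rw [hx]; simp
    · rw [hy]; simp [h1.1]

lemma withDoubleStars_encard_inc_center (i : Fin d × Bool) (b : Bool) :
    {f | (M.withDoubleStars d).Inc f (.inr (i, .inl b))}.encard = (d + 1 : ℕ) := by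
  have : {f | (M.withDoubleStars d).Inc f (.inr (i, .inl b))} =
      Set.range (fun o : Option (Fin d) => (.inr (o.elim (.inl i) (fun j => .inr (i, (j, b)))) :
        (Option (Fin d × Bool) × F) ⊕ ((Fin d × Bool) ⊕ ((Fin d × Bool) × (Fin d × Bool))))) := by
    ext e
    rcases e with x | j | ⟨j, p⟩
    · simp
    · simp only [Set.mem_ofPred_eq, withDoubleStars_inc_center_center, Set.mem_range]
      constructor
      · rintro rfl; exact ⟨none, rfl⟩
      · rintro ⟨_ | o, ho⟩
        · simpa using ho.symm
        · simp at ho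
    · simp only [Set.mem_ofPred_eq, withDoubleStars_inc_pendant_center, Set.mem_range]
      constructor
      · rintro ⟨rfl, rfl⟩; exact ⟨some p.1, rfl⟩
      · rintro ⟨_ | o, ho⟩
        · simp at ho
        · simp only [Option.elim_some, Sum.inr.injEq, Prod.mk.injEq] at ho
          exact ⟨ho.1.symm, by rw [← ho.2]⟩
  rw [this, ← Set.image_univ, Function.Injective.encard_image, Set.encard_univ,
    ENat.card_eq_coe_fintype_card]
  · simp
  · rintro (_ | a) (_ | b) h <;> simp at h ⊢; assumption

/-- Injectivity of `φ` on each side of a star makes the pendant edges at a centre differ in colour.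
The central edge differs from them because its colour belongs to the special copy. -/
lemma IsColored.withDoubleStars {κ : F → C} {a t : ℕ} (h : M.IsColored κ (d + 1) a)
    {φ : Fin d × Bool → C} (hinj : ∀ j k b, φ (j, b) = φ (k, b) → j = k)
    (ht : ∀ c, (t : ℕ∞) ≤ {p | φ p = c}.encard) :
    (M.withDoubleStars d).IsColored (doubleStarColor κ φ) (d + 1) (a + t) := by
  refine ⟨?_, ?_, ?_⟩
  · rintro (⟨g, e⟩ | i | ⟨i, p⟩) (⟨g', f⟩ | j | ⟨j, q⟩) (⟨g'', v⟩ | ⟨k, b | l⟩) hne he hf hc <;>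
      simp only [withDoubleStars_inc_copy_copy, withDoubleStars_inc_copy_star,
        withDoubleStars_inc_star_copy, withDoubleStars_inc_center_center,
        withDoubleStars_inc_center_leaf, withDoubleStars_inc_pendant_center,
        withDoubleStars_inc_pendant_leaf, doubleStarColor, Prod.mk.injEq, reduceCtorEq,
        false_and, Option.some.injEq] at he hf hc
    · refine h.proper e f v ?_ he.2 hf.2 hc.2
      rintro rfl
      exact hne (by rw [hc.1])
    · exact hne (by rw [he, hf])
    · obtain ⟨p1, p2⟩ := p
      obtain ⟨q1, q2⟩ := q
      obtain ⟨rfl, rfl⟩ := he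
      obtain ⟨rfl, rfl⟩ := hf
      exact hne (by rw [hinj _ _ _ hc.2])
    · exact hne (by rw [he.1, hf.1, he.2, hf.2])
  · rintro (⟨g, v⟩ | ⟨i, b | p⟩)
    · refine le_trans ?_ (h.degree_le v)
      have hi : Function.Injective (fun f : F => (.inl (g, f) : (Option (Fin d × Bool) × F) ⊕
          ((Fin d × Bool) ⊕ ((Fin d × Bool) × (Fin d × Bool))))) := by
        intro x y hxy; simpa using hxy
      rw [← hi.encard_image]
      refine Set.encard_le_encard ?_
      rintro (⟨g', f⟩ | e) hf
      · simp only [Set.mem_ofPred_eq, withDoubleStars_inc_copy_copy] at hf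
        exact ⟨f, hf.2, by rw [hf.1]⟩
      · simp at hf
    · exact (withDoubleStars_encard_inc_center i b).le
    · refine le_trans (Set.encard_le_one_iff.2 ?_) (by simp)
      rintro (x | j | ⟨j, q⟩) (y | k | ⟨k, q'⟩) h1 h2 <;> simp at h1 h2
      simp [h1, h2]
  · rintro ⟨g, c⟩
    set ι : F → (Option (Fin d × Bool) × F) ⊕
      ((Fin d × Bool) ⊕ ((Fin d × Bool) × (Fin d × Bool))) := fun f => .inl (g, f) with hι
    set ψ : Fin d × Bool → (Option (Fin d × Bool) × F) ⊕
      ((Fin d × Bool) ⊕ ((Fin d × Bool) × (Fin d × Bool))) :=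
        fun p => .inr (g.elim (.inl p) (fun i => .inr (i, p))) with hψ
    have hιi : Function.Injective ι := by intro x y hxy; simpa [hι] using hxy
    have hψi : Function.Injective ψ := by
      intro x y hxy
      cases g <;> simpa [hψ] using hxy
    have hsub : ι '' {f | κ f = c} ∪ ψ '' {p | φ p = c} ⊆ {f | doubleStarColor κ φ f = (g, c)} := by
      rintro _ (⟨f, hf, rfl⟩ | ⟨p, hp, rfl⟩)
      · simpa [hι, doubleStarColor] using hf
      · cases g <;> simpa [hψ, doubleStarColor] using hp
    have hdis : Disjoint (ι '' {f | κ f = c}) (ψ '' {p | φ p = c}) := by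
      rw [Set.disjoint_left]
      rintro _ ⟨f, hf, rfl⟩ ⟨p, hp, hpf⟩
      simp [hι, hψ] at hpf
    refine le_trans ?_ (Set.encard_le_encard hsub)
    rw [Set.encard_union_eq hdis, hιi.encard_image, hψi.encard_image]
    push_cast
    exact add_le_add (h.le_class c) (ht c)

lemma IsSimple.withDoubleStars (h : M.IsSimple) : (M.withDoubleStars d).IsSimple := by
  rintro (⟨g, e⟩ | i | ⟨i, p⟩) (⟨g', f⟩ | j | ⟨j, q⟩) (⟨g1, v⟩ | ⟨k, b | l⟩)
    (⟨g2, w⟩ | ⟨k', b' | l'⟩) hne h1 h2 h3 h4 <;>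
    simp only [withDoubleStars_inc_copy_copy, withDoubleStars_inc_copy_star,
        withDoubleStars_inc_star_copy, withDoubleStars_inc_center_center,
        withDoubleStars_inc_center_leaf, withDoubleStars_inc_pendant_center,
        withDoubleStars_inc_pendant_leaf] at h1 h2 h3 h4
  · obtain ⟨rfl, h1⟩ := h1
    obtain ⟨rfl, h2⟩ := h2
    obtain ⟨rfl, h3⟩ := h3
    rw [h e f v w (by simpa using hne) h1 h2 h3 h4.2]
  all_goals grind

lemma IsBipartiteWith.withDoubleStars {A : Set V} (h : M.IsBipartiteWith A) :
    (M.withDoubleStars d).IsBipartiteWith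
      {w | w.elim (fun x => x.2 ∈ A)
        (fun y => y.2.elim (fun b => b = true) (fun p => p.2 = false))} := by
  rintro (⟨g, e⟩ | i | ⟨i, p⟩)
  · simpa [Multigraph.withDoubleStars] using h e
  · simp [Multigraph.withDoubleStars]
  · simp [Multigraph.withDoubleStars]

lemma exists_coloring_withDoubleStars {k : ℕ} (hk : d + 1 ≤ k) {c : F → Fin k}
    (hc : ∀ e f v, e ≠ f → M.Inc e v → M.Inc f v → c e ≠ c f) :
    ∃ c' : _ → Fin k, ∀ e f v, e ≠ f → (M.withDoubleStars d).Inc e v →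
      (M.withDoubleStars d).Inc f v → c' e ≠ c' f := by
  -- The copies are disjoint and can share the colouring `c`; a double star needs `d` colours for
  -- the leaves of a centre, reused at the other centre, and one more for the central edge.
  refine ⟨fun e => match e with
    | .inl (_, f) => c f
    | .inr (.inl _) => ⟨d, hk⟩
    | .inr (.inr (_, p)) => ⟨p.1, by omega⟩, ?_⟩
  rintro (⟨g, e⟩ | i | ⟨i, p⟩) (⟨g', f⟩ | j | ⟨j, q⟩) (⟨g'', v⟩ | ⟨k, b | l⟩) hne he hf hc' <;>
      simp only [withDoubleStars_inc_copy_copy, withDoubleStars_inc_copy_star,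
        withDoubleStars_inc_star_copy, withDoubleStars_inc_center_center,
        withDoubleStars_inc_center_leaf, withDoubleStars_inc_pendant_center,
        withDoubleStars_inc_pendant_leaf, Fin.mk.injEq] at he hf hc'
  · refine hc e f v ?_ he.2 hf.2 hc'
    rintro rfl
    exact hne (by rw [he.1, hf.1])
  · exact hne (by rw [he, hf])
  · have := q.1.isLt; omega
  · have := p.1.isLt; omega
  · exact hne (by rw [he.1, hf.1, Prod.ext (Fin.ext hc') (he.2.trans hf.2.symm)])
  · exact hne (by rw [he.1, hf.1, he.2, hf.2])

lemma exists_pendant_colors [Fintype C] (h1 : d ≤ Fintype.card C) (h2 : Fintype.card C ≤ 2 * d) :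
    ∃ φ : Fin d × Bool → C, (∀ j k b, φ (j, b) = φ (k, b) → j = k) ∧
      ∀ c, ((1 : ℕ) : ℕ∞) ≤ {p | φ p = c}.encard := by
  let e := Fintype.equivFin C
  -- One side uses the first `d` colours and the other the last `d`; together they cover everything
  -- because there are at most `2 * d` colours.
  refine ⟨fun p => e.symm (bif p.2 then ⟨Fintype.card C - d + p.1, by omega⟩
    else ⟨p.1, by omega⟩), ?_, ?_⟩
  · rintro j k (_ | _) h <;> simpa [Fin.ext_iff] using h
  · intro c
    rw [Nat.cast_one, Set.one_le_encard_iff_nonempty]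
    by_cases h : (e c : ℕ) < d
    · exact ⟨(⟨e c, h⟩, false), by simp⟩
    · refine ⟨(⟨e c - (Fintype.card C - d), by omega⟩, true), ?_⟩
      simp only [cond_true, Set.mem_ofPred_eq, Equiv.symm_apply_eq, Fin.ext_iff]
      omega

lemma exists_pendant_colors_twice [Fintype C] (h : Fintype.card C = d) :
    ∃ φ : Fin d × Bool → C, (∀ j k b, φ (j, b) = φ (k, b) → j = k) ∧
      ∀ c, ((2 : ℕ) : ℕ∞) ≤ {p | φ p = c}.encard := by
  let e := Fintype.equivFinOfCardEq h
  refine ⟨fun p => e.symm p.1, fun j k b h => by simpa using h, fun c => ?_⟩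
  rw [Nat.cast_ofNat, ← Set.encard_pair (show ((e c, false) : Fin d × Bool) ≠ (e c, true) by simp)]
  refine Set.encard_le_encard ?_
  rintro _ (rfl | rfl) <;> simp

end DoubleStars

/-! ### Cyclic Latin squares of even order -/

section CyclicSquare

/-- The complete bipartite graph between two copies of `ZMod n`. -/
def completeBipartite (n : ℕ) : Multigraph (Bool × ZMod n) (ZMod n × ZMod n) where
  fst e := (false, e.1)
  snd e := (true, e.2)
  ne := by simp

variable {n : ℕ}

lemma completeBipartite_isSimple : (completeBipartite n).IsSimple := by
  rintro ⟨a, b⟩ ⟨c, d⟩ ⟨_ | _, x⟩ ⟨_ | _, y⟩ hne h1 h2 h3 h4 <;>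
    simp [Inc, completeBipartite] at * <;> grind

lemma completeBipartite_isBipartiteWith :
    (completeBipartite n).IsBipartiteWith {v | v.1 = true} := by
  intro e
  simp [completeBipartite]

lemma completeBipartite_isColored [NeZero n] {Δ : ℕ} (hn : n ≤ Δ) :
    (completeBipartite n).IsColored (fun e => e.1 + e.2) Δ n := by
  have hp : ∀ e f v, e ≠ f → (completeBipartite n).Inc e v → (completeBipartite n).Inc f v →
      e.1 + e.2 ≠ f.1 + f.2 := by
    rintro ⟨a, b⟩ ⟨c, d⟩ ⟨_ | _, x⟩ hne h1 h2 h <;>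
      simp [Inc, completeBipartite] at * <;> subst h1 <;> subst h2
    · exact hne rfl (add_left_cancel h)
    · exact hne (add_right_cancel h) rfl
  refine ⟨hp, fun v => (encard_inc_le hp v).trans ?_, fun a => ?_⟩
  · rw [ZMod.card]; exact_mod_cast hn
  · have hi : Function.Injective (fun x : ZMod n => (x, a - x)) := fun x y h => (Prod.ext_iff.1 h).1
    have : (n : ℕ∞) = (Set.univ : Set (ZMod n)).encard := by
      rw [Set.encard_univ, ENat.card_eq_coe_fintype_card, ZMod.card]
    rw [this, ← hi.encard_image]
    refine Set.encard_le_encard ?_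
    rintro _ ⟨x, _, rfl⟩
    simp

lemma sum_zmod_ne_zero [NeZero n] (hn : Even n) : ∑ x : ZMod n, x ≠ 0 := by
  obtain ⟨k, rfl⟩ := hn
  have hk : 0 < k := by have := NeZero.ne (k + k); omega
  intro h
  have h1 : ∑ x : ZMod (k + k), x = ((∑ i ∈ Finset.range (k + k), i : ℕ) : ZMod (k + k)) := by
    rw [Nat.cast_sum]
    symm
    refine Finset.sum_bij (fun i _ => (i : ZMod (k + k))) (fun _ _ => Finset.mem_univ _) ?_ ?_
      (fun _ _ => rfl)
    · intro a ha b hb hab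
      rw [Finset.mem_range] at ha hb
      simpa [ZMod.natCast_eq_natCast_iff', Nat.mod_eq_of_lt ha, Nat.mod_eq_of_lt hb] using hab
    · intro b _
      exact ⟨b.val, by simpa using ZMod.val_lt b, by simp⟩
  rw [h1, ZMod.natCast_eq_zero_iff] at h
  have h2 := Finset.sum_range_id_mul_two (k + k)
  obtain ⟨j, hj⟩ := h
  rw [hj] at h2
  obtain ⟨k, rfl⟩ : ∃ l, k = l + 1 := ⟨k - 1, by omega⟩
  -- Twice the sum of the representatives is `n (n - 1)`. If `n` divided the sum, then `n - 1` would
  -- be even.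
  rw [mul_assoc] at h2
  have := Nat.eq_of_mul_eq_mul_left (by omega) h2
  omega

/-- In a full rainbow matching both coordinates and the colours run through all of `ZMod n`, so `S +
S = S` for the sum `S` of all elements, that is, `S = 0`. -/
lemma completeBipartite_noFullRainbow [NeZero n] (hn : Even n) :
    (completeBipartite n).NoFullRainbow (fun e => e.1 + e.2) := by
  intro r hr
  by_contra! hno
  have h1 : Function.Injective (fun a => (r a).1) := by
    intro a b hab
    by_contra hne
    exact hno a b (false, (r a).1) hne (Or.inl rfl)
      (Or.inl (by simpa [completeBipartite] using hab.symm))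
  have h2 : Function.Injective (fun a => (r a).2) := by
    intro a b hab
    by_contra hne
    exact hno a b (true, (r a).2) hne (Or.inr rfl)
      (Or.inr (by simpa [completeBipartite] using hab.symm))
  have e1 := (Finite.injective_iff_bijective.1 h1).sum_comp (fun x => x)
  have e2 := (Finite.injective_iff_bijective.1 h2).sum_comp (fun x => x)
  have e3 : ∑ a, ((r a).1 + (r a).2) = ∑ a : ZMod n, a := Finset.sum_congr rfl fun a _ => hr a
  rw [Finset.sum_add_distrib, e1, e2] at e3
  exact sum_zmod_ne_zero hn (by simpa using e3)

end CyclicSquare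

/-! ### Translations of elementary abelian 2-groups -/

section Translations

variable {A C : Type*} [AddCommGroup A] [Fintype A] {q : ℕ}

/-- On `q` copies of the group `A`, all edges between `x` and `x + τ c` in the same copy, for each
colour `c`. When `2 • A = 0`, each edge is listed once, by its end that comes first in an arbitrary
enumeration of `A`. -/
def translationGraph (q : ℕ) (τ : C → A) (hτ : ∀ c, τ c ≠ 0) :
    Multigraph (Fin q × A) {e : Fin q × A × C //
      Fintype.equivFin A e.2.1 < Fintype.equivFin A (e.2.1 + τ e.2.2)} where
  fst e := (e.1.1, e.1.2.1)
  snd e := (e.1.1, e.1.2.1 + τ e.1.2.2)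
  ne e := by simpa using hτ e.1.2.2

variable {τ : C → A} {hτ : ∀ c, τ c ≠ 0}

lemma translationGraph_eq_of_inc (hA : ∀ x : A, x + x = 0) {e f : {e : Fin q × A × C //
      Fintype.equivFin A e.2.1 < Fintype.equivFin A (e.2.1 + τ e.2.2)}} {v : Fin q × A}
    (he : (translationGraph q τ hτ).Inc e v) (hf : (translationGraph q τ hτ).Inc f v)
    (h : e.1.2.2 = f.1.2.2) : e = f := by
  obtain ⟨⟨i, x, c⟩, hx⟩ := e
  obtain ⟨⟨j, y, d⟩, hy⟩ := f
  obtain rfl : c = d := h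
  obtain ⟨k, z⟩ := v
  have hcancel : ∀ u, u + τ c + τ c = u := fun u => by rw [add_assoc, hA, add_zero]
  simp only [Inc, translationGraph, Prod.mk.injEq] at he hf
  rcases he with ⟨rfl, rfl⟩ | ⟨rfl, rfl⟩ <;> rcases hf with ⟨rfl, rfl⟩ | ⟨rfl, h2⟩
  · rfl
  · subst h2
    simp only [hcancel] at hx hy
    exact absurd hx hy.asymm
  · simp only [hcancel] at hx hy
    exact absurd hx hy.asymm
  · simp only [add_left_inj] at h2
    subst h2
    rfl

lemma translationGraph_isColored [Fintype C] (hA : ∀ x : A, x + x = 0) {s Δ : ℕ}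
    (hcard : q * Fintype.card A = 2 * s) (hΔ : Fintype.card C ≤ Δ) :
    (translationGraph q τ hτ).IsColored (fun e => e.1.2.2) Δ s := by
  have hp : ∀ e f v, e ≠ f → (translationGraph q τ hτ).Inc e v → (translationGraph q τ hτ).Inc f v →
      e.1.2.2 ≠ f.1.2.2 := fun e f v hne he hf h => hne (translationGraph_eq_of_inc hA he hf h)
  refine ⟨hp, fun v => (encard_inc_le hp v).trans (by exact_mod_cast hΔ), fun c => ?_⟩
  classical
  set ρ := Fintype.equivFin A
  set lo := Finset.univ.filter (fun v : Fin q × A => ρ v.2 < ρ (v.2 + τ c)) with hlo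
  -- Translation by `τ c` sends vertices that are not first ends to first ends, so at least half of
  -- all vertices are first ends of edges of colour `c`.
  have h1 : (Finset.univ.filter (fun v : Fin q × A => ¬ ρ v.2 < ρ (v.2 + τ c))).card ≤ lo.card := by
    refine Finset.card_le_card_of_injOn (fun v => (v.1, v.2 + τ c)) ?_ ?_
    · intro v hv
      simp only [Finset.coe_filter, Finset.mem_univ, true_and, Set.mem_ofPred_eq, not_lt, hlo] at hv ⊢
      rw [add_assoc, hA, add_zero]
      refine lt_of_le_of_ne hv fun h => hτ c ?_
      simpa using ρ.injective h
    · intro v _ w _ h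
      simpa [Prod.ext_iff] using h
  have h2 := Finset.card_filter_add_card_filter_not (s := (Finset.univ : Finset (Fin q × A)))
    (fun v : Fin q × A => ρ v.2 < ρ (v.2 + τ c))
  rw [Finset.card_univ, Fintype.card_prod, Fintype.card_fin, hcard] at h2
  have h3 : s ≤ lo.card := by
    change lo.card + _ = _ at h2
    omega
  have hi : Function.Injective (fun v : lo => (⟨(v.1.1, v.1.2, c), by
      exact (Finset.mem_filter.1 v.2).2⟩ : {e : Fin q × A × C //
      Fintype.equivFin A e.2.1 < Fintype.equivFin A (e.2.1 + τ e.2.2)})) := by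
    intro v w h
    have h := congrArg (fun e => e.1) h
    simp only [Prod.mk.injEq, and_true] at h
    exact Subtype.ext (Prod.ext h.1 h.2)
  calc (s : ℕ∞) ≤ lo.card := by exact_mod_cast h3
    _ = (Set.univ : Set lo).encard := by
      rw [Set.encard_univ, ENat.card_eq_coe_fintype_card, Fintype.card_coe]
    _ = _ := (hi.encard_image _).symm
    _ ≤ _ := Set.encard_le_encard (by rintro _ ⟨v, _, rfl⟩; rfl)

lemma translationGraph_noFullRainbow [Fintype C] (hA : ∀ x : A, x + x = 0)
    (hcard : q * Fintype.card A = 2 * (Fintype.card C + 1)) (hq : Even q)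
    (hA2 : Even (Fintype.card A)) (hsum : ∑ c, τ c = 0) :
    (translationGraph q τ hτ).NoFullRainbow (fun e => e.1.2.2) := by
  classical
  intro r hr
  by_contra! hno
  -- The weight records both the group element and the copy, so it determines the vertex. An edge
  -- has both ends in one copy, so its two ends sum to `(τ c, 0)`.
  let L : Fin q × A → A × (Fin q → ZMod 2) := fun v => (v.2, Pi.single v.1 1)
  have hB : ∀ b : A × (Fin q → ZMod 2), b + b = 0 := fun b =>
    Prod.ext (hA _) (funext fun i => CharTwo.add_self_eq_zero (b.2 i))
  have hev : ∀ {k : ℕ} (_ : Even k) (b : A × (Fin q → ZMod 2)), k • b = 0 := by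
    rintro _ ⟨k, rfl⟩ b
    rw [add_smul, ← smul_add, hB, smul_zero]
  have hL : Function.Injective L := by
    rintro ⟨i, x⟩ ⟨j, y⟩ h
    obtain ⟨h1, h2⟩ := Prod.ext_iff.1 h
    obtain rfl : x = y := h1
    by_contra hij
    have hij : i ≠ j := fun h => hij (by rw [h])
    have := congrFun h2 i
    simp [L, hij] at this
  have htot : ∑ v, L v = 0 := by
    have : ∀ v, L v = (v.2, 0) + (0, Pi.single v.1 1) := fun v => by simp [L]
    simp_rw [this, Finset.sum_add_distrib, Fintype.sum_prod_type, Finset.sum_const,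
      Finset.card_univ, Fintype.card_fin, hev hq, ← Finset.smul_sum, hev hA2, add_zero]
  let g : C × Bool → Fin q × A := fun p =>
    bif p.2 then (translationGraph q τ hτ).fst (r p.1) else (translationGraph q τ hτ).snd (r p.1)
  have hinc : ∀ p, (translationGraph q τ hτ).Inc (r p.1) (g p) := by
    rintro ⟨c, _ | _⟩
    · exact Or.inr rfl
    · exact Or.inl rfl
  have hg : Function.Injective g := by
    rintro ⟨a, b⟩ ⟨a', b'⟩ h
    obtain rfl : a = a' := by
      by_contra hne
      exact hno a a' _ hne (hinc (a, b)) (h ▸ hinc (a', b'))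
    have := (translationGraph q τ hτ).ne (r a)
    rcases b <;> rcases b' <;> simp [g] at h ⊢
    · exact this h.symm
    · exact this h
  have himg : ∑ v ∈ Finset.univ.image g, L v = 0 := by
    rw [Finset.sum_image (fun a _ b _ h => hg h), Fintype.sum_prod_type]
    have : ∀ c, ∑ b, L (g (c, b)) = (τ c, 0) := by
      intro c
      have hc : (r c).1.2.2 = c := hr c
      rw [Fintype.sum_bool]
      refine Prod.ext ?_ (funext fun i => ?_)
      · change (r c).1.2.1 + ((r c).1.2.1 + τ (r c).1.2.2) = τ c
        rw [← add_assoc, hA, zero_add, hc]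
      · exact CharTwo.add_self_eq_zero _
    simp_rw [this]
    have h2 : ∑ c, ((τ c, 0) : A × (Fin q → ZMod 2)) = (∑ c, τ c, 0) :=
      (map_sum (AddMonoidHom.inl A (Fin q → ZMod 2)) τ Finset.univ).symm
    rw [h2, hsum]; rfl
  -- The matching covers `2|C|` of the `2(|C| + 1)` vertices. The two others have weights summing to
  -- zero, hence equal weights in characteristic 2.
  have hcomp : ((Finset.univ.image g)ᶜ).card = 2 := by
    rw [Finset.card_compl, Finset.card_image_of_injective _ hg, Finset.card_univ, Fintype.card_prod,
      Fintype.card_prod, Fintype.card_fin, hcard, Fintype.card_bool]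
    omega
  obtain ⟨u, v, huv, hset⟩ := Finset.card_eq_two.1 hcomp
  have hadd := Finset.sum_add_sum_compl (Finset.univ.image g) L
  rw [himg, htot, hset, Finset.sum_pair huv, zero_add] at hadd
  refine huv (hL ?_)
  rw [eq_neg_of_add_eq_zero_left hadd, neg_eq_of_add_eq_zero_left (hB _)]

lemma translationGraph_isSimple (hA : ∀ x : A, x + x = 0) (hinj : Function.Injective τ) :
    (translationGraph q τ hτ).IsSimple := by
  intro e f x y hne h1 h2 h3 h4
  have key : ∀ g, (translationGraph q τ hτ).Inc g x → (translationGraph q τ hτ).Inc g y →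
      τ g.1.2.2 = x.2 + y.2 := by
    rintro ⟨⟨i, z, c⟩, hz⟩ hx hy
    simp only [Inc, translationGraph] at hx hy
    have hzz : z + τ c + z = τ c := by rw [add_right_comm, hA, zero_add]
    rcases hx with rfl | rfl <;> rcases hy with rfl | rfl
    · exact absurd rfl hne
    · simp [← add_assoc, hA]
    · exact hzz.symm
    · exact absurd rfl hne
  exact translationGraph_eq_of_inc hA h1 h3 (hinj ((key e h1 h2).trans (key f h3 h4).symm))

end Translations

/-! ### Triangles with multiple edges -/

section FatTriangles

/-- `N` disjoint triangles, with `χ` edges distributed equally between the three sides. -/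
def fatTriangles (N χ : ℕ) : Multigraph (Fin N × Fin 3) (Fin N × Fin χ) where
  fst e := (e.1, ⟨e.2 % 3, Nat.mod_lt _ (by norm_num)⟩)
  snd e := (e.1, (⟨e.2 % 3, Nat.mod_lt _ (by norm_num)⟩ : Fin 3) + 1)
  ne e h := (by decide : ∀ s : Fin 3, s ≠ s + 1) _ (congrArg Prod.snd h)

variable {N χ : ℕ}

lemma fatTriangles_exists_common_end (i : Fin N) (a b : Fin χ) :
    ∃ v, (fatTriangles N χ).Inc (i, a) v ∧ (fatTriangles N χ).Inc (i, b) v := by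
  have key : ∀ s t : Fin 3, ∃ u, (s = u ∨ s + 1 = u) ∧ (t = u ∨ t + 1 = u) := by decide
  obtain ⟨u, h1, h2⟩ := key ⟨a % 3, Nat.mod_lt _ (by norm_num)⟩ ⟨b % 3, Nat.mod_lt _ (by norm_num)⟩
  exact ⟨(i, u), by simpa [Inc, fatTriangles] using h1, by simpa [Inc, fatTriangles] using h2⟩

lemma fatTriangles_isColored {Δ : ℕ} (h : 2 * χ ≤ 3 * Δ) :
    (fatTriangles N χ).IsColored (fun e => e.2) Δ N := by
  refine ⟨?_, ?_, ?_⟩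
  · rintro ⟨i, a⟩ ⟨j, b⟩ ⟨k, v⟩ hne h1 h2 (rfl : a = b)
    simp only [Inc, fatTriangles, Prod.mk.injEq] at h1 h2
    grind
  · rintro ⟨i, v⟩
    -- Side `w` is the one opposite to `v`. It has at least `χ / 3` edges, which leaves at most `χ -
    -- χ / 3 ≤ Δ` edges at `v`.
    set w : Fin 3 := v + 1 with hw
    have h1 : {e | (fatTriangles N χ).Inc e (i, v)} ⊆
        (fun a => (i, a)) ''
          ((Finset.univ.filter fun a : Fin χ => ¬ (a : ℕ) % 3 = w) : Set (Fin χ)) := by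
      rintro ⟨j, a⟩ hja
      have key : ∀ s t : Fin 3, (s = t ∨ s + 1 = t) → s ≠ t + 1 := by decide
      simp only [Set.mem_ofPred_eq, Inc, fatTriangles, Prod.mk.injEq, ← and_or_left] at hja
      refine ⟨a, ?_, by rw [hja.1]⟩
      have := key _ _ hja.2
      simp only [ne_eq, Fin.ext_iff] at this
      simpa using this
    refine (Set.encard_le_encard h1).trans ((Set.encard_image_le _ _).trans ?_)
    rw [Set.encard_coe_eq_coe_finsetCard]
    have h2 := Finset.card_filter_add_card_filter_not (s := (Finset.univ : Finset (Fin χ)))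
      (fun a => (a : ℕ) % 3 = w)
    have h3 : (Finset.univ : Finset (Fin (χ / 3))).card ≤
        (Finset.univ.filter fun a : Fin χ => (a : ℕ) % 3 = w).card := by
      refine Finset.card_le_card_of_injOn
        (fun j => ⟨3 * j + w, by have := j.isLt; have := w.isLt; omega⟩) ?_ ?_
      · intro j _
        have := w.isLt
        simp only [Finset.coe_filter, Finset.mem_univ, true_and, Set.mem_ofPred_eq]
        omega
      · intro j _ k _ hjk
        simpa [Fin.ext_iff] using hjk
    rw [Finset.card_univ, Fintype.card_fin] at h2 h3
    have : (Finset.univ.filter fun a : Fin χ => ¬ (a : ℕ) % 3 = w).card ≤ Δ := by omega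
    exact_mod_cast this
  · intro a
    have hi : Function.Injective (fun i : Fin N => (i, a)) := fun i j h => (Prod.ext_iff.1 h).1
    have : (N : ℕ∞) = (Set.univ : Set (Fin N)).encard := by
      rw [Set.encard_univ, ENat.card_eq_coe_fintype_card, Fintype.card_fin]
    rw [this, ← hi.encard_image]
    refine Set.encard_le_encard ?_
    rintro _ ⟨i, _, rfl⟩
    rfl

lemma fatTriangles_noFullRainbow (h : N < χ) :
    (fatTriangles N χ).NoFullRainbow (fun e => e.2) := by
  intro r hr
  obtain ⟨a, b, hab, h⟩ := Fintype.exists_ne_map_eq_of_card_lt (fun a => (r a).1) (by simpa using h)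
  obtain ⟨v, h1, h2⟩ := fatTriangles_exists_common_end (r a).1 (r a).2 (r b).2
  exact ⟨a, b, v, hab, h1, by rwa [show r b = ((r a).1, (r b).2) from Prod.ext h.symm rfl]⟩

end FatTriangles

/-! ### Disjoint unions -/

section DisjointSum

variable {V F C W E D : Type*} (M : Multigraph V F) (N : Multigraph W E)

/-- The disjoint union of two multigraphs. -/
def disjointSum : Multigraph (V ⊕ W) (F ⊕ E) where
  fst := Sum.map M.fst N.fst
  snd := Sum.map M.snd N.snd
  ne := by
    rintro (f | e)
    · simpa using M.ne f
    · simpa using N.ne e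

variable {M N}

@[simp] lemma disjointSum_inc_inl_inl {f : F} {v : V} :
    (M.disjointSum N).Inc (.inl f) (.inl v) ↔ M.Inc f v := by simp [Inc, disjointSum]

@[simp] lemma disjointSum_inc_inr_inr {f : E} {v : W} :
    (M.disjointSum N).Inc (.inr f) (.inr v) ↔ N.Inc f v := by simp [Inc, disjointSum]

@[simp] lemma disjointSum_inc_inl_inr {f : F} {v : W} :
    ¬ (M.disjointSum N).Inc (.inl f) (.inr v) := by simp [Inc, disjointSum]

@[simp] lemma disjointSum_inc_inr_inl {f : E} {v : V} :
    ¬ (M.disjointSum N).Inc (.inr f) (.inl v) := by simp [Inc, disjointSum]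

lemma disjointSum_setOf_inc_inl (v : V) :
    {f | (M.disjointSum N).Inc f (.inl v)} = Sum.inl '' {f | M.Inc f v} := by
  ext (f | e) <;> simp

lemma disjointSum_setOf_inc_inr (w : W) :
    {f | (M.disjointSum N).Inc f (.inr w)} = Sum.inr '' {f | N.Inc f w} := by
  ext (f | e) <;> simp

lemma IsColored.disjointSum {κ : F → C} {μ : E → D} {Δ T : ℕ} (h : M.IsColored κ Δ T)
    (h' : N.IsColored μ Δ T) : (M.disjointSum N).IsColored (Sum.map κ μ) Δ T := by
  refine ⟨?_, ?_, ?_⟩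
  · rintro (e | e) (f | f) (v | v) hne he hf hc <;> simp at he hf hc
    · exact h.proper e f v (by simpa using hne) he hf hc
    · exact h'.proper e f v (by simpa using hne) he hf hc
  · rintro (v | w)
    · rw [disjointSum_setOf_inc_inl, Sum.inl_injective.encard_image]
      exact h.degree_le v
    · rw [disjointSum_setOf_inc_inr, Sum.inr_injective.encard_image]
      exact h'.degree_le w
  · rintro (a | a)
    · refine (h.le_class a).trans ?_
      rw [← (Sum.inl_injective (β := E)).encard_image]
      refine Set.encard_le_encard ?_
      rintro _ ⟨f, hf, rfl⟩
      simpa using hf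
    · refine (h'.le_class a).trans ?_
      rw [← (Sum.inr_injective (α := F)).encard_image]
      refine Set.encard_le_encard ?_
      rintro _ ⟨f, hf, rfl⟩
      simpa using hf

lemma NoFullRainbow.disjointSum {κ : F → C} (h : M.NoFullRainbow κ) (μ : E → D) :
    (M.disjointSum N).NoFullRainbow (Sum.map κ μ) := by
  intro r hr
  have : ∀ a, ∃ f, r (.inl a) = .inl f ∧ κ f = a := by
    intro a
    have h1 := hr (.inl a)
    rcases hra : r (.inl a) with f | e
    · exact ⟨f, rfl, by simpa [hra] using h1⟩
    · simp [hra] at h1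
  choose r' hr' hκ using this
  obtain ⟨a, b, v, hab, ha, hb⟩ := h r' hκ
  exact ⟨.inl a, .inl b, .inl v, by simpa using hab, by rw [hr']; simpa using ha,
    by rw [hr']; simpa using hb⟩

end DisjointSum

/-! ### Passage to `Graph` -/

section ToGraph

variable {V F C : Type*} (M : Multigraph V F)

/-- The graph with vertex set and edge set the full types. -/
def toGraph : Graph V F where
  vertexSet := Set.univ
  IsLink f x y := (M.fst f = x ∧ M.snd f = y) ∨ (M.fst f = y ∧ M.snd f = x)
  edgeSet := Set.univ
  isLink_symm := fun _ _ => ⟨fun _ _ => Or.symm⟩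
  eq_or_eq_of_isLink_of_isLink := by grind
  edge_mem_iff_exists_isLink := fun f => iff_of_true trivial ⟨_, _, Or.inl ⟨rfl, rfl⟩⟩
  left_mem_of_isLink := fun _ _ _ _ => trivial

variable {M}

lemma toGraph_inc {f : F} {v : V} : M.toGraph.Inc f v ↔ M.Inc f v := by
  constructor
  · rintro ⟨y, h | h⟩
    · exact Or.inl h.1
    · exact Or.inr h.2
  · rintro (h | h)
    · exact ⟨M.snd f, Or.inl ⟨h, rfl⟩⟩
    · exact ⟨M.fst f, Or.inr ⟨rfl, h⟩⟩

lemma toGraph_loopless : M.toGraph.Loopless := by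
  refine ⟨fun f x h => M.ne f ?_⟩
  rcases h with h | h <;> exact h.1.trans h.2.symm

lemma toGraph_isFiniteMultigraph [Finite V] [Finite F] : M.toGraph.IsFiniteMultigraph :=
  ⟨Set.toFinite _, Set.toFinite _, toGraph_loopless⟩

lemma IsSimple.toGraph (h : M.IsSimple) : M.toGraph.Simple where
  toLoopless := toGraph_loopless
  eq_of_isLink e f x y he hf := by
    have := toGraph_loopless (M := M)
    exact h e f x y he.ne (toGraph_inc.1 he.inc_left) (toGraph_inc.1 he.inc_right)
      (toGraph_inc.1 hf.inc_left) (toGraph_inc.1 hf.inc_right)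

lemma IsBipartiteWith.toGraph {A : Set V} (h : M.IsBipartiteWith A) : M.toGraph.IsBipartite := by
  refine ⟨A, fun e x y hxy => ?_⟩
  have := h e
  rcases hxy with ⟨rfl, rfl⟩ | ⟨rfl, rfl⟩ <;> tauto

lemma toGraph_maxDegree_eq {Δ : ℕ} (hle : ∀ v, {f | M.Inc f v}.encard ≤ Δ) {v : V}
    (hv : Δ ≤ {f | M.Inc f v}.encard) : M.toGraph.maxDegree = Δ := by
  have h : ∀ v, M.toGraph.incidenceSet v = {f | M.Inc f v} := fun v => by
    ext f; exact toGraph_inc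
  unfold Graph.maxDegree
  simp only [h]
  exact le_antisymm (iSup₂_le fun v _ => hle v) (hv.trans (le_iSup₂_of_le v trivial le_rfl))

lemma exists_toGraph_coloring [Finite F] [Fintype C] {κ : F → C} {Δ T : ℕ}
    (h : M.IsColored κ Δ T) (h' : M.NoFullRainbow κ) :
    ∃ (n : ℕ) (c : E(M.toGraph) → Fin n), M.toGraph.IsProperEdgeColoring c ∧
      (∀ i, T ≤ (M.toGraph.colorClass c i).ncard) ∧
      ¬ ∃ S, M.toGraph.IsFullRainbowMatching c S := by
  let ε := Fintype.equivFin C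
  refine ⟨Fintype.card C, fun e => ε (κ e), ?_, ?_, ?_⟩
  · rintro i e he f hf hne x ⟨h1, h2⟩
    refine h.proper e f x (by simpa [Subtype.ext_iff] using hne) (toGraph_inc.1 h1)
      (toGraph_inc.1 h2) (ε.injective ?_)
    exact he.trans hf.symm
  · intro i
    have h1 := h.le_class (ε.symm i)
    have hi : Function.Injective (fun f : F => (⟨f, trivial⟩ : E(M.toGraph))) := fun a b hab =>
      congrArg Subtype.val hab
    rw [← hi.encard_image] at h1
    rw [← Nat.cast_le (α := ℕ∞), Set.Finite.cast_ncard_eq (Set.toFinite _)]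
    refine h1.trans (Set.encard_le_encard ?_)
    rintro _ ⟨f, hf, rfl⟩
    change ε (κ f) = i
    rw [show κ f = ε.symm i from hf, Equiv.apply_symm_apply]
  · rintro ⟨S, hS, hex⟩
    have : ∀ a, ∃ e ∈ S, κ e = a := by
      intro a
      obtain ⟨e, ⟨he, hc⟩, _⟩ := hex (ε a)
      exact ⟨e, he, ε.injective hc⟩
    choose r hr hκ using this
    obtain ⟨a, b, v, hab, ha, hb⟩ := h' (fun a => r a) hκ
    refine hS (r a) (hr a) (r b) (hr b) ?_ v ⟨toGraph_inc.2 ha, toGraph_inc.2 hb⟩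
    intro hrab
    exact hab (by rw [← hκ a, ← hκ b, hrab])

lemma toGraph_chromaticIndex_le {k : ℕ} {c : F → Fin k}
    (hc : ∀ e f v, e ≠ f → M.Inc e v → M.Inc f v → c e ≠ c f) :
    M.toGraph.chromaticIndex ≤ k := by
  refine iInf₂_le k ⟨fun e => c e, ?_⟩
  rintro i e he f hf hne x ⟨h1, h2⟩
  exact hc e f x (by simpa [Subtype.ext_iff] using hne) (toGraph_inc.1 h1) (toGraph_inc.1 h2)
    (he.trans hf.symm)

end ToGraph

end Multigraph

/-! ### Bounds on the chromatic index -/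

namespace Graph

variable {α β : Type*} {G : Graph α β}

/-- Edges that pairwise have common ends receive different colours. -/
lemma encard_le_chromaticIndex (A : Set E(G)) (hA : ∀ e ∈ A, ∀ f ∈ A, ∃ x, G.Inc e x ∧ G.Inc f x) :
    A.encard ≤ G.chromaticIndex := by
  refine le_iInf₂ fun n hn => ?_
  obtain ⟨c, hc⟩ := hn
  have hinj : Set.InjOn c A := by
    intro e he f hf hef
    by_contra hne
    obtain ⟨x, hx⟩ := hA e he f hf
    exact hc (c f) e hef f rfl hne x hx
  rw [← hinj.encard_image]
  refine (Set.encard_le_encard (Set.subset_univ _)).trans ?_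
  rw [Set.encard_univ, ENat.card_eq_coe_fintype_card, Fintype.card_fin]

lemma maxDegree_le_chromaticIndex : G.maxDegree ≤ G.chromaticIndex := by
  refine iSup₂_le fun v _ => ?_
  have h := encard_le_chromaticIndex (G := G) (Subtype.val ⁻¹' G.incidenceSet v)
    (fun e he f hf => ⟨v, he, hf⟩)
  rwa [← Subtype.val_injective.encard_image, Set.image_preimage_eq_of_subset] at h
  rw [Subtype.range_coe]
  exact G.incidenceSet_subset_edgeSet v

/-- Shannon's bound on the chromatic index. -/
theorem two_mul_chromaticIndex_le (hG : G.IsFiniteMultigraph) {Δ χ : ℕ} (hΔ : G.maxDegree = Δ)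
    (hχ : G.chromaticIndex = χ) : 2 * χ ≤ 3 * Δ := by
  classical
  have := hG.finite_vertexSet.to_subtype
  have := hG.finite_edgeSet.to_subtype
  have := hG.loopless
  have := Fintype.ofFinite V(G)
  have := Fintype.ofFinite E(G)
  have hends : ∀ e : E(G), ∃ p : V(G) × V(G), G.IsLink e p.1 p.2 := fun e => by
    obtain ⟨x, y, h⟩ := exists_isLink_of_mem_edgeSet e.2
    exact ⟨(⟨x, h.left_mem⟩, ⟨y, h.right_mem⟩), h⟩
  choose p hp using hends
  let M : Multigraph V(G) E(G) :=
    { fst := fun e => (p e).1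
      snd := fun e => (p e).2
      ne := fun e h => (hp e).ne (congrArg Subtype.val h) }
  have hinc : ∀ e (v : V(G)), M.Inc e v ↔ G.Inc e v := by
    intro e v
    constructor
    · rintro (rfl | rfl)
      · exact (hp e).inc_left
      · exact (hp e).inc_right
    · intro h
      rcases h.eq_or_eq_of_isLink (hp e) with h | h
      · exact Or.inl (Subtype.ext h.symm)
      · exact Or.inr (Subtype.ext h.symm)
  have hdeg : ∀ v, (Finset.univ.filter fun f => M.Inc f v).card ≤ Δ := by
    intro v
    have h1 : (G.incidenceSet v).encard ≤ Δ := by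
      rw [← hΔ]
      exact le_iSup₂_of_le (v : α) v.2 le_rfl
    rw [← Nat.cast_le (α := ℕ∞), ← Set.encard_coe_eq_coe_finsetCard]
    refine le_trans ?_ h1
    rw [← (Subtype.val_injective (p := (· ∈ E(G)))).encard_image]
    refine Set.encard_le_encard ?_
    rintro _ ⟨e, he, rfl⟩
    simpa [hinc] using he
  obtain ⟨c, hc⟩ := M.exists_coloring_of_degree_le (C := Fin (3 * Δ / 2)) hdeg (by
    rw [Fintype.card_fin]; omega)
  have hle : G.chromaticIndex ≤ (3 * Δ / 2 : ℕ) := by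
    refine iInf₂_le (3 * Δ / 2) ⟨c, ?_⟩
    rintro i e he f hf hne x ⟨h1, h2⟩
    exact hc e f ⟨x, h1.vertex_mem⟩ hne ((hinc _ _).2 h1) ((hinc _ _).2 h2) (he.trans hf.symm)
  rw [hχ, Nat.cast_le] at hle
  omega

end Graph

/-! ### Assembling the examples -/

namespace Multigraph

/-- A colouring with at least `d` colours and classes of size `a`, without full rainbow matching,
yields one with classes of size `a + 1`; if there are exactly `d` colours, then even `a + 2`. -/
lemma exists_isColored_withDoubleStars {V F C : Type*} [Fintype C] {M : Multigraph V F} {κ : F → C}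
    {d a T : ℕ} (h : M.IsColored κ (d + 1) a) (h' : M.NoFullRainbow κ)
    (hC : (Fintype.card C = d ∧ T = a + 2) ∨
      (d ≤ Fintype.card C ∧ Fintype.card C ≤ 2 * d ∧ T = a + 1)) :
    ∃ κ' : _ → Option (Fin d × Bool) × C, (M.withDoubleStars d).IsColored κ' (d + 1) T ∧
      (M.withDoubleStars d).NoFullRainbow κ' := by
  rcases hC with ⟨hC, rfl⟩ | ⟨h1, h2, rfl⟩
  · obtain ⟨φ, hφ, hφ'⟩ := exists_pendant_colors_twice hC
    exact ⟨_, h.withDoubleStars hφ hφ', h'.withDoubleStars φ⟩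
  · obtain ⟨φ, hφ, hφ'⟩ := exists_pendant_colors h1 h2
    exact ⟨_, h.withDoubleStars hφ hφ', h'.withDoubleStars φ⟩

lemma toGraph_withDoubleStars_maxDegree {V F C : Type*} {M : Multigraph V F} {d T : ℕ} (hd : 1 ≤ d)
    {κ : _ → C} (h : (M.withDoubleStars d).IsColored κ (d + 1) T) :
    (M.withDoubleStars d).toGraph.maxDegree = (d + 1 : ℕ) :=
  toGraph_maxDegree_eq h.degree_le
    (withDoubleStars_encard_inc_center (M := M) ((⟨0, hd⟩, true) : Fin d × Bool) true).ge

/-- In the complete bipartite graph `K_{n,n}` with its cyclic colouring, the number of colours is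
the greatest even number that is at most `d + 1`. -/
lemma exists_bipartite_isColored {d : ℕ} (hd : 1 ≤ d) :
    ∃ (n : ℕ) (_ : NeZero n) (κ : _ → Option (Fin d × Bool) × ZMod n),
      ((completeBipartite n).withDoubleStars d).IsColored κ (d + 1) (d + 2) ∧
      ((completeBipartite n).withDoubleStars d).NoFullRainbow κ := by
  -- For `n = d` the gadget adds two edges to each class, for `n = d + 1` it adds one; both give `d
  -- + 2`.
  rcases Nat.even_or_odd d with h | h
  · have : NeZero d := ⟨by omega⟩
    obtain ⟨κ, hκ⟩ := exists_isColored_withDoubleStars (d := d) (T := d + 2)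
      (completeBipartite_isColored d.le_succ) (completeBipartite_noFullRainbow h)
      (Or.inl ⟨ZMod.card d, rfl⟩)
    exact ⟨d, this, κ, hκ⟩
  · obtain ⟨κ, hκ⟩ := exists_isColored_withDoubleStars (d := d) (T := d + 2)
      (completeBipartite_isColored le_rfl) (completeBipartite_noFullRainbow h.add_one)
      (Or.inr (by rw [ZMod.card]; omega))
    exact ⟨d + 1, inferInstance, κ, hκ⟩

/-- The example obtained from a translation graph: its parallel edges come from colours with the
same translation. -/
lemma exists_translation_example {A C : Type} [AddCommGroup A] [Fintype A] [Fintype C] {q Δ : ℕ}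
    {τ : C → A} (hτ : ∀ c, τ c ≠ 0) (hA : ∀ x : A, x + x = 0)
    (hcard : q * Fintype.card A = 2 * (Fintype.card C + 1)) (hq : Even q)
    (hA2 : Even (Fintype.card A)) (hsum : ∑ c, τ c = 0) (hC : 2 ≤ Fintype.card C)
    (hΔ : Δ = Fintype.card C ∨ Δ = Fintype.card C + 1) :
    ∃ (V F : Type) (G : Graph V F), (Function.Injective τ → G.Simple) ∧
      G.IsFiniteMultigraph ∧ G.maxDegree = Δ ∧ G.chromaticIndex = Δ ∧
        ∃ (n : ℕ) (c : E(G) → Fin n), G.IsProperEdgeColoring c ∧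
          (∀ i, Δ + 2 ≤ (G.colorClass c i).ncard) ∧
          ¬ ∃ M, G.IsFullRainbowMatching c M := by
  obtain ⟨d, rfl⟩ : ∃ d, Δ = d + 1 := ⟨Δ - 1, by omega⟩
  have h1 : (translationGraph q τ hτ).IsColored (fun e => e.1.2.2) (d + 1) (Fintype.card C + 1) :=
    translationGraph_isColored hA hcard (by omega)
  -- The base classes have size `|C| + 1`. The gain is two if `|C| = d` and one if `|C| = d + 1`;
  -- the latter needs `d + 1 ≤ 2 * d`, hence `2 ≤ |C|`.
  obtain ⟨κ, hκ, hκ'⟩ := exists_isColored_withDoubleStars (d := d) (T := d + 1 + 2) h1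
    (translationGraph_noFullRainbow hA hcard hq hA2 hsum) (by omega)
  have hmax := toGraph_withDoubleStars_maxDegree (by omega) hκ
  have hcol : ∃ c : {e : Fin q × A × C // Fintype.equivFin A e.2.1 <
      Fintype.equivFin A (e.2.1 + τ e.2.2)} → Fin (d + 1), ∀ e f v, e ≠ f →
      (translationGraph q τ hτ).Inc e v → (translationGraph q τ hτ).Inc f v → c e ≠ c f := by
    refine ⟨fun e => Fin.castLE (by omega) (Fintype.equivFin C e.1.2.2), ?_⟩
    intro e f v hne he hf h
    exact h1.proper e f v hne he hf (by simpa using h)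
  obtain ⟨c, hc⟩ := hcol
  obtain ⟨c', hc'⟩ := exists_coloring_withDoubleStars (d := d) le_rfl hc
  refine ⟨_, _, ((translationGraph q τ hτ).withDoubleStars d).toGraph,
    fun hinj => (translationGraph_isSimple hA hinj).withDoubleStars.toGraph,
    toGraph_isFiniteMultigraph, hmax, ?_, exists_toGraph_coloring hκ hκ'⟩
  exact le_antisymm (toGraph_chromaticIndex_le hc') (hmax ▸ Graph.maxDegree_le_chromaticIndex)

lemma exists_multigraph_example {Δ : ℕ} (h3 : 3 ≤ Δ) (hΔ : Δ % 4 = 3 ∨ Δ % 4 = 0) :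
    ∃ (V F : Type) (G : Graph V F),
      G.IsFiniteMultigraph ∧ G.maxDegree = Δ ∧ G.chromaticIndex = Δ ∧
        ∃ (n : ℕ) (c : E(G) → Fin n), G.IsProperEdgeColoring c ∧
          (∀ i, Δ + 2 ≤ (G.colorClass c i).ncard) ∧
          ¬ ∃ M, G.IsFullRainbowMatching c M := by
  obtain ⟨k, hk⟩ : ∃ k, Δ = 4 * k + 3 ∨ Δ = 4 * k + 4 := ⟨(Δ - 3) / 4, by omega⟩
  -- The translations `(1, 0)` and `(0, 1)` occur once and `(1, 1)` occurs `4 * k + 1` times, an odd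
  -- number, so the total is zero.
  let τ : Fin (4 * k + 3) → ZMod 2 × ZMod 2 :=
    Fin.cons (1, 0) (Fin.cons (0, 1) (fun _ => (1, 1)) : Fin (4 * k + 2) → ZMod 2 × ZMod 2)
  have hτ : ∀ c, τ c ≠ 0 := by
    intro c
    refine Fin.cases ?_ (fun c => Fin.cases ?_ (fun c => ?_) c) c <;>
      simp only [τ, Fin.cons_zero, Fin.cons_succ] <;> decide
  have hA : ∀ x : ZMod 2 × ZMod 2, x + x = 0 := by decide
  have hsum : ∑ c, τ c = 0 := by
    rw [Fin.sum_univ_succ, Fin.sum_univ_succ]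
    simp only [τ, Fin.cons_zero, Fin.cons_succ, Finset.sum_const, Finset.card_univ,
      Fintype.card_fin]
    rw [show 4 * k + 1 = (2 * k + 2 * k) + 1 by ring, add_smul, add_smul, hA]
    decide
  obtain ⟨V, F, G, -, hG⟩ := exists_translation_example (q := 2 * (k + 1)) (Δ := Δ) hτ hA
    (by simp only [Fintype.card_prod, ZMod.card, Fintype.card_fin]; ring) (even_two_mul _)
    (by simp [Nat.even_iff]) hsum (by rw [Fintype.card_fin]; omega)
    (by rw [Fintype.card_fin]; omega)
  exact ⟨V, F, G, hG⟩

lemma exists_simple_example {m Δ : ℕ} (hm : 2 ≤ m) (hΔ : Δ = 2 ^ m - 1 ∨ Δ = 2 ^ m) :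
    ∃ (V F : Type) (G : Graph V F),
      G.IsFiniteMultigraph ∧ G.Simple ∧ G.maxDegree = Δ ∧ G.chromaticIndex = Δ ∧
        ∃ (n : ℕ) (c : E(G) → Fin n), G.IsProperEdgeColoring c ∧
          (∀ i, Δ + 2 ≤ (G.colorClass c i).ncard) ∧
          ¬ ∃ M, G.IsFullRainbowMatching c M := by
  classical
  obtain ⟨k, rfl⟩ : ∃ k, m = k + 2 := ⟨m - 2, by omega⟩
  -- Colours are the nonzero elements of `B × ZMod 2`, each acting as its own translation. Their sum
  -- vanishes since `B` and `ZMod 2` both have even order.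
  let B := Fin (k + 1) → ZMod 2
  have hB : ∀ x : B, x + x = 0 := fun x => funext fun i => CharTwo.add_self_eq_zero (x i)
  have hA : ∀ x : B × ZMod 2, x + x = 0 := fun x =>
    Prod.ext (hB _) (CharTwo.add_self_eq_zero x.2)
  have hcA : Fintype.card (B × ZMod 2) = 2 ^ (k + 2) := by
    simp [B, ZMod.card, pow_succ]
  have hpow : 2 ^ (k + 2) = 4 * 2 ^ k := by ring
  have hpos : 0 < 2 ^ k := by positivity
  have hcC : Fintype.card {x : B × ZMod 2 // x ≠ 0} = 2 ^ (k + 2) - 1 := by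
    rw [Fintype.card_subtype_compl, hcA, Fintype.card_subtype_eq]
  have hsum : ∑ c : {x : B × ZMod 2 // x ≠ 0}, (c : B × ZMod 2) = 0 := by
    have h1 : ∑ c : {x : B × ZMod 2 // x ≠ 0}, (c : B × ZMod 2) = ∑ x : B × ZMod 2, x := by
      rw [← Finset.sum_subtype (Finset.univ.erase 0) (by simp) (fun x => x)]
      exact Finset.sum_erase _ rfl
    have h2 : ∀ x : B × ZMod 2, x = (x.1, 0) + (0, x.2) := fun x => by simp
    rw [h1, Finset.sum_congr rfl (fun x _ => h2 x), Finset.sum_add_distrib, Fintype.sum_prod_type,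
      Fintype.sum_prod_type]
    simp only [Finset.sum_const, Finset.card_univ]
    rw [← Finset.smul_sum, ZMod.card, two_smul, hA, zero_add]
    rw [show Fintype.card B = 2 ^ k + 2 ^ k by simp [B, ZMod.card]; ring, add_smul, hA]
  obtain ⟨V, F, G, h, hG⟩ := exists_translation_example (q := 2) (Δ := Δ)
    (τ := fun c : {x : B × ZMod 2 // x ≠ 0} => c.1) (fun c => c.2) hA
    (by rw [hcA, hcC]; omega) even_two
    (by rw [hcA, pow_succ]; exact even_two.mul_left _) hsum (by omega) (by omega)
  exact ⟨V, F, G, hG.1, h Subtype.val_injective, hG.2⟩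

/-- The edges of one fat triangle, embedded by `ι`, pairwise meet and need `χ` colours. -/
lemma le_chromaticIndex_toGraph {V F : Type*} {M : Multigraph V F} {N χ : ℕ} (i : Fin N)
    (ι : Fin N × Fin χ → F) (hι : Function.Injective ι)
    (h : ∀ a b, ∃ v, M.Inc (ι (i, a)) v ∧ M.Inc (ι (i, b)) v) :
    χ ≤ M.toGraph.chromaticIndex := by
  have hi : Function.Injective (fun a => (⟨ι (i, a), trivial⟩ : E(M.toGraph))) := fun a b hab =>
    (Prod.ext_iff.1 (hι (congrArg Subtype.val hab))).2
  have := Graph.encard_le_chromaticIndex (G := M.toGraph)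
    (Set.range (fun a => (⟨ι (i, a), trivial⟩ : E(M.toGraph)))) (by
      rintro _ ⟨a, rfl⟩ _ ⟨b, rfl⟩
      obtain ⟨v, h1, h2⟩ := h a b
      exact ⟨v, toGraph_inc.2 h1, toGraph_inc.2 h2⟩)
  rwa [← Set.image_univ, hi.encard_image, Set.encard_univ, ENat.card_eq_coe_fintype_card,
    Fintype.card_fin] at this

/-- For all possible values of the maximum degree and of the chromatic index, there is an example
whose colour classes are at least as large as the chromatic index. -/
lemma exists_chromaticIndex_example {Δ χ : ℕ} (hΔ : 2 ≤ Δ) (hle : Δ ≤ χ) (hχ : 2 * χ ≤ 3 * Δ) :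
    ∃ (V F : Type) (G : Graph V F),
      G.IsFiniteMultigraph ∧ G.maxDegree = Δ ∧ G.chromaticIndex = χ ∧
        ∃ (n : ℕ) (c : E(G) → Fin n), G.IsProperEdgeColoring c ∧
          (∀ i, χ ≤ (G.colorClass c i).ncard) ∧ ¬ ∃ M, G.IsFullRainbowMatching c M := by
  obtain ⟨d, rfl⟩ : ∃ d, Δ = d + 1 := ⟨Δ - 1, by omega⟩
  -- The gadget can enlarge all `χ` classes only if `χ ≤ 2 * d`; under Shannon's bound the sole
  -- exception is `Δ = 2`, `χ = 3`.
  by_cases hd : χ ≤ 2 * d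
  · have h1 : (fatTriangles (χ - 1) χ).IsColored (fun e => e.2) (d + 1) (χ - 1) :=
      fatTriangles_isColored hχ
    obtain ⟨κ, hκ, hκ'⟩ := exists_isColored_withDoubleStars (d := d) (T := χ) h1
      (fatTriangles_noFullRainbow (by omega)) (by rw [Fintype.card_fin]; omega)
    obtain ⟨c, hc⟩ := exists_coloring_withDoubleStars (d := d) hle h1.proper
    refine ⟨_, _, ((fatTriangles (χ - 1) χ).withDoubleStars d).toGraph, toGraph_isFiniteMultigraph,
      toGraph_withDoubleStars_maxDegree (by omega) hκ,
      le_antisymm (toGraph_chromaticIndex_le hc) ?_, exists_toGraph_coloring hκ hκ'⟩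
    refine le_chromaticIndex_toGraph (N := χ - 1) ⟨0, by omega⟩ (fun e => .inl (none, e))
      (fun a b h => by simpa using h) fun a b => ?_
    obtain ⟨v, h1, h2⟩ := fatTriangles_exists_common_end (⟨0, by omega⟩ : Fin (χ - 1)) a b
    exact ⟨.inl (none, v), by simpa using h1, by simpa using h2⟩
  · obtain rfl : d = 1 := by omega
    obtain rfl : χ = 3 := by omega
    -- In the exceptional case the obstruction comes from `K_{2,2}`, and disjoint triangles with
    -- separate colours only raise the chromatic index to 3.
    obtain ⟨κ, hκ, hκ'⟩ := exists_isColored_withDoubleStars (d := 1) (T := 3)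
      (completeBipartite_isColored (n := 2) le_rfl) (completeBipartite_noFullRainbow even_two)
      (Or.inr (by rw [ZMod.card]; omega))
    have h3 : (fatTriangles 3 3).IsColored (fun e => e.2) 2 3 := fatTriangles_isColored hχ
    have hp := (completeBipartite_isColored (n := 2) le_rfl).proper
    obtain ⟨c, hc⟩ := exists_coloring_withDoubleStars (M := completeBipartite 2) (d := 1) (k := 3)
      (by omega) (c := fun e => (e.1 + e.2).castSucc)
      (fun e f v hne he hf h => hp e f v hne he hf (Fin.castSucc_injective 2 h))
    have hsum := hκ.disjointSum h3
    refine ⟨_, _,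
      (((completeBipartite 2).withDoubleStars 1).disjointSum (fatTriangles 3 3)).toGraph,
      toGraph_isFiniteMultigraph, ?_, ?_, exists_toGraph_coloring hsum (hκ'.disjointSum _)⟩
    · refine toGraph_maxDegree_eq hsum.degree_le (v := .inl (.inr ((0, true), .inl true))) ?_
      rw [disjointSum_setOf_inc_inl, Sum.inl_injective.encard_image]
      exact (withDoubleStars_encard_inc_center _ _).ge
    · refine le_antisymm (toGraph_chromaticIndex_le (c := Sum.elim c fun e => e.2) ?_) ?_
      · rintro (e | e) (f | f) (v | v) hne he hf <;> simp at he hf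
        · exact hc e f v (by simpa using hne) he hf
        · exact h3.proper e f v (by simpa using hne) he hf
      · refine le_chromaticIndex_toGraph (N := 3) 0 .inr Sum.inr_injective fun a b => ?_
        obtain ⟨v, h1, h2⟩ := fatTriangles_exists_common_end (0 : Fin 3) a b
        exact ⟨.inr v, by simpa using h1, by simpa using h2⟩

lemma exists_bipartite_example {Δ : ℕ} (hΔ : 2 ≤ Δ) :
    ∃ (V F : Type) (G : Graph V F),
      G.IsFiniteMultigraph ∧ G.Simple ∧ G.IsBipartite ∧ G.maxDegree = Δ ∧
        ∃ (n : ℕ) (c : E(G) → Fin n), G.IsProperEdgeColoring c ∧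
          (∀ i, Δ + 1 ≤ (G.colorClass c i).ncard) ∧
          ¬ ∃ M, G.IsFullRainbowMatching c M := by
  obtain ⟨d, rfl⟩ : ∃ d, Δ = d + 1 := ⟨Δ - 1, by omega⟩
  obtain ⟨n, _, κ, hκ, hκ'⟩ := exists_bipartite_isColored (d := d) (by omega)
  exact ⟨_, _, ((completeBipartite n).withDoubleStars d).toGraph, toGraph_isFiniteMultigraph,
    completeBipartite_isSimple.withDoubleStars.toGraph,
    completeBipartite_isBipartiteWith.withDoubleStars.toGraph,
    toGraph_withDoubleStars_maxDegree (by omega) hκ, exists_toGraph_coloring hκ hκ'⟩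

end Multigraph

theorem mainTheorem2 :
    -- (1)
    (∀ (α β : Type*) (H : Graph α β) (Δ χ : ℕ),
      H.IsFiniteMultigraph → 2 ≤ Δ → H.maxDegree = Δ → H.chromaticIndex = χ →
      ∃ (V F : Type) (G : Graph V F),
        G.IsFiniteMultigraph ∧ G.maxDegree = Δ ∧ G.chromaticIndex = χ ∧
        ∃ (n : ℕ) (c : E(G) → Fin n), G.IsProperEdgeColoring c ∧
          (∀ i, χ - 1 ≤ (G.colorClass c i).ncard) ∧
          (E(H).ncard ≤ 2 * Δ - 1 → ∀ i, χ ≤ (G.colorClass c i).ncard) ∧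
          ¬ ∃ M, G.IsFullRainbowMatching c M) ∧
    -- (2)
    (∀ Δ : ℕ, 2 ≤ Δ →
      ∃ (V F : Type) (G : Graph V F),
        G.IsFiniteMultigraph ∧ G.Simple ∧ G.IsBipartite ∧ G.maxDegree = Δ ∧
        ∃ (n : ℕ) (c : E(G) → Fin n), G.IsProperEdgeColoring c ∧
          (∀ i, Δ + 1 ≤ (G.colorClass c i).ncard) ∧
          ¬ ∃ M, G.IsFullRainbowMatching c M) ∧
    -- (3), multigraphs
    (∀ Δ : ℕ, 3 ≤ Δ → (Δ % 4 = 3 ∨ Δ % 4 = 0) →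
      ∃ (V F : Type) (G : Graph V F),
        G.IsFiniteMultigraph ∧ G.maxDegree = Δ ∧ G.chromaticIndex = Δ ∧
        ∃ (n : ℕ) (c : E(G) → Fin n), G.IsProperEdgeColoring c ∧
          (∀ i, Δ + 2 ≤ (G.colorClass c i).ncard) ∧
          ¬ ∃ M, G.IsFullRainbowMatching c M) ∧
    -- (3), simple graphs
    (∀ m Δ : ℕ, 2 ≤ m → (Δ = 2 ^ m - 1 ∨ Δ = 2 ^ m) →
      ∃ (V F : Type) (G : Graph V F),
        G.IsFiniteMultigraph ∧ G.Simple ∧ G.maxDegree = Δ ∧ G.chromaticIndex = Δ ∧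
        ∃ (n : ℕ) (c : E(G) → Fin n), G.IsProperEdgeColoring c ∧
          (∀ i, Δ + 2 ≤ (G.colorClass c i).ncard) ∧
          ¬ ∃ M, G.IsFullRainbowMatching c M) ∧
    -- the resulting disproof of both conjectures
    ¬ DelcourtPostleBipartiteConjecture ∧ ¬ DelcourtPostleGeneralConjecture := by
  refine ⟨?_, fun Δ hΔ => Multigraph.exists_bipartite_example hΔ,
    fun Δ h3 hΔ => Multigraph.exists_multigraph_example h3 hΔ,
    fun m Δ hm hΔ => Multigraph.exists_simple_example hm hΔ, ?_, ?_⟩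
  · intro α β H Δ χ hH hΔ hmax hχ
    have hle : Δ ≤ χ := by
      have := H.maxDegree_le_chromaticIndex
      rwa [hmax, hχ, Nat.cast_le] at this
    obtain ⟨V, F, G, h1, h2, h3, n, c, h4, h5, h6⟩ :=
      Multigraph.exists_chromaticIndex_example hΔ hle (Graph.two_mul_chromaticIndex_le hH hmax hχ)
    exact ⟨V, F, G, h1, h2, h3, n, c, h4, fun i => (Nat.sub_le _ _).trans (h5 i), fun _ => h5, h6⟩
  · intro h
    obtain ⟨V, F, G, h1, -, h2, h3, n, c, h4, h5, h6⟩ :=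
      Multigraph.exists_bipartite_example (le_refl 2)
    exact h6 (h V F G 2 n c h1 h2 h3 h4 h5)
  · intro h
    obtain ⟨V, F, G, h1, h2, -, n, c, h4, h5, h6⟩ :=
      Multigraph.exists_multigraph_example (le_refl 3) (Or.inl rfl)
    exact h6 (h V F G 3 n c h1 h2 h4 h5)
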